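/- Let $\mathbb K$ be a field. A category $\mathcal A$ is called *regular* (in the sense of Knop) if it has a terminal object $\mathbf 1$; every morphism has an image; the pullback $x\times_z y$ exists whenever $x\to z\leftarrow y$ can be completed to a commutative square, and also whenever $x\to z$ is an epimorphism; and epimorphisms are stable under pullback. Here and below "epimorphism" means extremal epimorphism, i.e. an epimorphism that does not factor through a proper subobject of its target; this is the same as an epimorphism in a category in which every morphism that is both mono and epi is an isomorphism. A *degree function* on $\mathcal A$ is a map $\delta$ from the epimorphisms of $\mathcal A$ to $\mathbb K$ with $\delta(\mathrm{id}_x)=1$, $\delta(e'e)=\delta(e')\delta(e)$ for composable epimorphisms $e,e'$, and $\delta(e')=\delta(e)$ whenever $e'$ is a pullback of $e$. The category $\mathcal T^0(\mathcal A,\delta)$ has an object $[x]$ for each object $x$ of $\mathcal A$; a morphism $[x]\to[y]$ is a formal $\mathbb K$-linear combination of relations, where a relation $\langle r\rangle$ is a subobject $r\subset x\times y$ (an isomorphism class of jointly monic pairs $x\leftarrow r\to y$). Composition is bilinear, with $\langle s\rangle\circ\langle r\rangle=\delta(e)\,\langle s\star r\rangle$ if $r\times_y s$ exists, where $s\star r$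 is the image of $r\times_y s\to x\times z$ and $e:r\times_y s\twoheadrightarrow s\star r$ is the projection, and $\langle s\rangle\circ\langle r\rangle=0$ otherwise. The category $\mathcal T(\mathcal A,\delta)$ is the additive Karoubi completion of $\mathcal T^0(\mathcal A,\delta)$. It is a $\mathbb K$-linear symmetric monoidal category with unit $[\mathbf 1]$, with $[x]\otimes[y]=[x\times y]$ (and $[x]\otimes[y]=0$ if $x\times y$ does not exist) and $\langle r\rangle\otimes\langle r'\rangle=\langle r\times r'\rangle$ (and $0$ if $r\times r'$ does not exist). Let $\mathcal A$ be a regular category with a degree function $\delta$, and let $x_0$ be an object of $\mathcal A$ such that $x\times x_0$ exists for every $x\in\mathcal A$. The slice category $\mathcal A/x_0$ is regular, and it carries the induced degree function $\delta'(e)=\delta(e)$. Let $F=(-)\times x_0:\mathcal A\to\mathcal A/x_0$, and let $\overline F:\mathcal T(\mathcal A,\delta)\to\mathcal T(\mathcal A/x_0,\delta')$ be the functor induced by $[x]\mapsto[F(x)]$, $\langle r\rangle\mapsto\langle F(r)\rangle$. Then: 1. $F$ is right adjoint to the forgetful functor $G:\mathcal A/x_0\to\mathcal A$, by an adjunction with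 unit $\eta:\mathrm{Id}\to FG$ and counit $\varepsilon:GF\to\mathrm{Id}$ all of whose naturality squares are Cartesian; 2. $F$ preserves finite limits (all those that exist in $\mathcal A$); 3. $\overline F$ is $\mathbb K$-linear and symmetric monoidal, and it preserves finite limits (all those that exist in $\mathcal T(\mathcal A,\delta)$). In particular, let $\mathbb F_q$ be a finite field, $\mathrm{Vect}_{\mathbb F_q}$ the category of finite-dimensional $\mathbb F_q$-vector spaces, $t\in\mathbb K$, $\delta_t(e)=t^{\dim\ker e}$ for surjective linear maps $e$, and $\underline{\mathrm{Rep}}(GL_t(\mathbb F_q)):=\mathcal T(\mathrm{Vect}_{\mathbb F_q},\delta_t)$. Then for every $V_0\in\mathrm{Vect}_{\mathbb F_q}$, with $\delta'_t$ the degree function on $\mathrm{Vect}_{\mathbb F_q}/V_0$ induced by $\delta_t$, the functor $\overline F:\underline{\mathrm{Rep}}(GL_t(\mathbb F_q))\to\mathcal T(\mathrm{Vect}_{\mathbb F_q}/V_0,\delta'_t)$ induced by $F=(-)\oplus V_0$ is $\mathbb K$-linear, symmetric monoidal and preserves finite limits. -/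

import Mathlib

open CategoryTheory CategoryTheory.Limits

universe w v u v' u'

namespace DeligneKnop

/-- Regular categories in the sense of Knop. Finite limits are not required to exist: the pullback
of a cospan has to exist as soon as the cospan can be completed to a commutative square, or one of
its legs is an extremal epimorphism. -/
class KnopRegular (A : Type u) [Category.{v} A] : Prop where
  hasTerminal : HasTerminal A
  hasImages : HasImages A
  hasPullback_of_commSq : ∀ {w x y z : A} (p : w ⟶ x) (q : w ⟶ y) (f : x ⟶ z) (g : y ⟶ z),
    p ≫ f = q ≫ g → HasPullback f g
  hasPullback_of_extremalEpi : ∀ {x y z : A} (f : x ⟶ z) (g : y ⟶ z) [ExtremalEpi f],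
    HasPullback f g
  extremalEpi_of_isPullback : ∀ {p x y z : A} {fst : p ⟶ x} {snd : p ⟶ y} {f : x ⟶ z} {g : y ⟶ z},
    IsPullback fst snd f g → ExtremalEpi f → ExtremalEpi snd

attribute [instance] KnopRegular.hasTerminal KnopRegular.hasImages

/-- A `K`-valued degree function: a function on (extremal) epimorphisms that is multiplicative and
invariant under pullback. -/
structure DegreeFunction (A : Type u) [Category.{v} A] (K : Type w) [CommRing K] where
  deg : ∀ {x y : A} (e : x ⟶ y) [ExtremalEpi e], K
  deg_id : ∀ x : A, deg (𝟙 x) = 1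
  deg_comp : ∀ {x y z : A} (e : x ⟶ y) (e' : y ⟶ z) [ExtremalEpi e] [ExtremalEpi e']
    [ExtremalEpi (e ≫ e')], deg (e ≫ e') = deg e' * deg e
  deg_pullback : ∀ {p x y z : A} {fst : p ⟶ x} {snd : p ⟶ y} {e : x ⟶ z} {g : y ⟶ z}
    [ExtremalEpi e] [ExtremalEpi snd], IsPullback fst snd e g → deg snd = deg e

/-- A jointly monic pair of morphisms `x ← apex → y`. When the product exists this is the same as
a monomorphism into `x ⨯ y`. -/
structure RelSpan {A : Type u} [Category.{v} A] (x y : A) where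
  apex : A
  fst : apex ⟶ x
  snd : apex ⟶ y
  jointlyMono : ∀ {w : A} (g h : w ⟶ apex), g ≫ fst = h ≫ fst → g ≫ snd = h ≫ snd → g = h

/-- Isomorphism of jointly monic pairs. -/
instance relSetoid {A : Type u} [Category.{v} A] (x y : A) : Setoid (RelSpan x y) where
  r r s := ∃ i : r.apex ≅ s.apex, i.hom ≫ s.fst = r.fst ∧ i.hom ≫ s.snd = r.snd
  iseqv :=
    { refl := fun r => ⟨Iso.refl _, by simp, by simp⟩
      symm := by
        rintro r s ⟨i, h1, h2⟩
        exact ⟨i.symm, by simp [← h1], by simp [← h2]⟩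
      trans := by
        rintro r s t ⟨i, h1, h2⟩ ⟨j, h3, h4⟩
        exact ⟨i ≪≫ j, by simp [h3, h1], by simp [h4, h2]⟩ }

/-- A relation between `x` and `y`: a subobject of `x ⨯ y`, that is, an isomorphism class of
jointly monic pairs `x ← r → y`. -/
def Relation {A : Type u} [Category.{v} A] (x y : A) : Type (max u v) := Quotient (relSetoid x y)

/-- The relation given by a jointly monic pair. -/
def Relation.mk {A : Type u} [Category.{v} A] {x y : A} (r : RelSpan x y) : Relation x y :=
  Quotient.mk _ r

theorem Relation.mk_eq {A : Type u} [Category.{v} A] {x y : A} {r s : RelSpan x y}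
    (i : r.apex ≅ s.apex) (h1 : i.hom ≫ s.fst = r.fst) (h2 : i.hom ≫ s.snd = r.snd) :
    Relation.mk r = Relation.mk s :=
  Quotient.sound ⟨i, h1, h2⟩

section Regular

variable {A : Type u} [Category.{v} A] [KnopRegular A]

theorem hasBinaryProduct_of_maps {w x y : A} (p : w ⟶ x) (q : w ⟶ y) : HasBinaryProduct x y := by
  have : HasPullback (terminal.from x) (terminal.from y) :=
    KnopRegular.hasPullback_of_commSq p q _ _ (terminal.hom_ext _ _)
  exact ⟨⟨_, isProductOfIsTerminalIsPullback _ _ _ _ terminalIsTerminal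
    (pullbackIsPullback (terminal.from x) (terminal.from y))⟩⟩

theorem strongEpi_of_extremalEpi {x y : A} (e : x ⟶ y) [ExtremalEpi e] : StrongEpi e where
  epi := inferInstance
  llp := fun X Y i _ => ⟨fun {t b} sq => by
    have := KnopRegular.hasPullback_of_commSq t e i b sq.w
    have := ExtremalEpi.isIso e (pullback.lift t e sq.w) (pullback.snd i b) (pullback.lift_snd _ _ _)
    exact ⟨⟨{ l := inv (pullback.snd i b) ≫ pullback.fst _ _
              fac_left := by
                rw [← cancel_mono i, sq.w, Category.assoc, Category.assoc]
                congr 1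
                rw [← cancel_epi (pullback.snd i b), IsIso.hom_inv_id_assoc, pullback.condition]
              fac_right := by simp [pullback.condition] }⟩⟩⟩

instance (priority := low) extremalEpi_comp {x y z : A} (e : x ⟶ y) (e' : y ⟶ z) [ExtremalEpi e]
    [ExtremalEpi e'] : ExtremalEpi (e ≫ e') := by
  have := strongEpi_of_extremalEpi e
  have := strongEpi_of_extremalEpi e'
  have := strongEpi_comp e e'
  infer_instance

/-- The projection of a morphism onto its image is an extremal epimorphism. -/
instance extremalEpi_factorThruImage {x y : A} (f : x ⟶ y) : ExtremalEpi (factorThruImage f) := by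
  have key : ∀ {z : A} (p : x ⟶ z) (i : z ⟶ image f) (_ : p ≫ i = factorThruImage f) [Mono i],
      IsIso i := by
    intro z p i fac _
    let F : MonoFactorisation f :=
      { I := z, m := i ≫ image.ι f, e := p, fac := by rw [← Category.assoc, fac, image.fac] }
    have h : image.lift F ≫ i = 𝟙 _ := by
      rw [← cancel_mono (image.ι f), Category.assoc, Category.id_comp]
      exact image.lift_fac F
    exact ⟨image.lift F, by rw [← cancel_mono i, Category.assoc, h]; simp, h⟩
  have : Epi (factorThruImage f) := by
    refine ⟨fun {w} g h hgh => ?_⟩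
    have := hasBinaryProduct_of_maps (𝟙 (image f)) g
    have : Mono (prod.lift (𝟙 (image f)) g) := mono_of_mono_fac (prod.lift_fst _ _)
    have : Mono (prod.lift (𝟙 (image f)) h) := mono_of_mono_fac (prod.lift_fst _ _)
    have w : factorThruImage f ≫ prod.lift (𝟙 (image f)) g =
      factorThruImage f ≫ prod.lift (𝟙 (image f)) h := by ext <;> simp [hgh]
    have := KnopRegular.hasPullback_of_commSq _ _ _ _ w
    have := key (pullback.lift _ _ w) (pullback.fst _ _) (pullback.lift_fst _ _ _)
    have c := pullback.condition (f := prod.lift (𝟙 (image f)) g)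
      (g := prod.lift (𝟙 (image f)) h)
    have c1 := c =≫ prod.fst
    have c2 := c =≫ prod.snd
    simp only [Category.assoc, prod.lift_fst, prod.lift_snd, Category.comp_id] at c1 c2
    rw [← c1, cancel_epi] at c2
    exact c2
  exact { isIso := fun p i fac _ => key p i fac }

end Regular

section SpanCalculus

variable {A : Type u} [Category.{v} A] {K : Type w} [CommRing K] (δ : DegreeFunction A K)

theorem deg_congr {x y : A} {e e' : x ⟶ y} (h : e = e') [ExtremalEpi e] [ExtremalEpi e'] :
    δ.deg e = δ.deg e' := by
  subst h
  rfl

theorem deg_iso {x y : A} (i : x ⟶ y) [IsIso i] : δ.deg i = 1 := by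
  rw [δ.deg_pullback (IsPullback.of_vert_isIso ⟨rfl⟩ : IsPullback i i (𝟙 y) (𝟙 y)), δ.deg_id]

variable [KnopRegular A]

/-- The image of `(a, b) : p → x ⨯ y`, as a jointly monic pair. -/
noncomputable def imageSpan {p x y : A} (a : p ⟶ x) (b : p ⟶ y) : RelSpan x y :=
  haveI : HasBinaryProduct x y := hasBinaryProduct_of_maps a b
  { apex := image (prod.lift a b)
    fst := image.ι (prod.lift a b) ≫ prod.fst
    snd := image.ι (prod.lift a b) ≫ prod.snd
    jointlyMono := fun g h h1 h2 => by
      rw [← cancel_mono (image.ι (prod.lift a b))]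
      ext
      · simpa using h1
      · simpa using h2 }

/-- The projection of `p` onto the image of `(a, b) : p → x ⨯ y`. -/
noncomputable def imageProj {p x y : A} (a : p ⟶ x) (b : p ⟶ y) : p ⟶ (imageSpan a b).apex :=
  haveI : HasBinaryProduct x y := hasBinaryProduct_of_maps a b
  factorThruImage (prod.lift a b)

instance extremalEpi_imageProj {p x y : A} (a : p ⟶ x) (b : p ⟶ y) :
    ExtremalEpi (imageProj a b) := by
  exact extremalEpi_factorThruImage _

theorem imageProj_fst {p x y : A} (a : p ⟶ x) (b : p ⟶ y) :
    imageProj a b ≫ (imageSpan a b).fst = a := by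
  have : HasBinaryProduct x y := hasBinaryProduct_of_maps a b
  simp [imageProj, imageSpan, prod.lift_fst]

theorem imageProj_snd {p x y : A} (a : p ⟶ x) (b : p ⟶ y) :
    imageProj a b ≫ (imageSpan a b).snd = b := by
  have : HasBinaryProduct x y := hasBinaryProduct_of_maps a b
  simp [imageProj, imageSpan, prod.lift_snd]

/-- The linear combination `δ(e) • ⟨im (p → x ⨯ y)⟩`, with `e : p ↠ im (p → x ⨯ y)`, given by a pair
of morphisms `x ← p → y`. -/
noncomputable def spanClass {p x y : A} (a : p ⟶ x) (b : p ⟶ y) : Relation x y →₀ K :=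
  Finsupp.single (Relation.mk (imageSpan a b)) (δ.deg (imageProj a b))

theorem exists_factor {p x y : A} (a : p ⟶ x) (b : p ⟶ y) :
    ∃ (r : RelSpan x y) (e : p ⟶ r.apex) (_ : ExtremalEpi e), e ≫ r.fst = a ∧ e ≫ r.snd = b :=
  ⟨imageSpan a b, imageProj a b, inferInstance, imageProj_fst a b, imageProj_snd a b⟩

/-- Uniqueness of image factorizations. -/
theorem exists_relSpan_iso {p x y : A} (r s : RelSpan x y) (e : p ⟶ r.apex) (e' : p ⟶ s.apex)
    [ExtremalEpi e] [ExtremalEpi e'] (h1 : e ≫ r.fst = e' ≫ s.fst) (h2 : e ≫ r.snd = e' ≫ s.snd) :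
    ∃ i : r.apex ≅ s.apex, e ≫ i.hom = e' ∧ i.hom ≫ s.fst = r.fst ∧ i.hom ≫ s.snd = r.snd := by
  have : HasBinaryProduct x y := hasBinaryProduct_of_maps r.fst r.snd
  have mono : ∀ t : RelSpan x y, Mono (prod.lift t.fst t.snd) := fun t => ⟨fun g h hgh =>
    t.jointlyMono g h (by simpa [prod.lift_fst] using hgh =≫ prod.fst)
      (by simpa [prod.lift_snd] using hgh =≫ prod.snd)⟩
  have := mono r
  have := mono s
  have := strongEpi_of_extremalEpi e
  have := strongEpi_of_extremalEpi e'
  have sq1 : CommSq e' e (prod.lift s.fst s.snd) (prod.lift r.fst r.snd) :=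
    ⟨by simp [h1, h2]⟩
  have sq2 : CommSq e e' (prod.lift r.fst r.snd) (prod.lift s.fst s.snd) :=
    ⟨by simp [h1, h2]⟩
  refine ⟨⟨sq1.lift, sq2.lift, ?_, ?_⟩, ?_, ?_, ?_⟩
  · rw [← cancel_mono (prod.lift r.fst r.snd), Category.assoc, sq2.fac_right, sq1.fac_right,
      Category.id_comp]
  · rw [← cancel_mono (prod.lift s.fst s.snd), Category.assoc, sq1.fac_right, sq2.fac_right,
      Category.id_comp]
  · simp
  · simpa only [Category.assoc, prod.lift_fst] using sq1.fac_right =≫ prod.fst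
  · simpa only [Category.assoc, prod.lift_snd] using sq1.fac_right =≫ prod.snd

theorem spanClass_eq_single {p x y : A} (r : RelSpan x y) (e : p ⟶ r.apex) [ExtremalEpi e] :
    spanClass δ (e ≫ r.fst) (e ≫ r.snd) = Finsupp.single (Relation.mk r) (δ.deg e) := by
  obtain ⟨i, hi, h1, h2⟩ := exists_relSpan_iso r (imageSpan (e ≫ r.fst) (e ≫ r.snd)) e
    (imageProj (e ≫ r.fst) (e ≫ r.snd)) (imageProj_fst _ _).symm (imageProj_snd _ _).symm
  rw [spanClass, ← Relation.mk_eq i h1 h2, ← deg_congr δ hi, δ.deg_comp, deg_iso, one_mul]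

theorem spanClass_rel {x y : A} (r : RelSpan x y) :
    spanClass δ r.fst r.snd = Finsupp.single (Relation.mk r) 1 := by
  have h := spanClass_eq_single δ r (𝟙 _)
  rw [δ.deg_id] at h
  simpa using h

theorem spanClass_epi {p q x y : A} (e : p ⟶ q) [ExtremalEpi e] (a : q ⟶ x) (b : q ⟶ y) :
    spanClass δ (e ≫ a) (e ≫ b) = δ.deg e • spanClass δ a b := by
  obtain ⟨r, f, _, rfl, rfl⟩ := exists_factor a b
  rw [spanClass_eq_single, ← Category.assoc, ← Category.assoc, spanClass_eq_single, δ.deg_comp]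
  rw [Finsupp.smul_single, smul_eq_mul, mul_comm]

theorem spanClass_congr {p q x y : A} (i : p ⟶ q) [IsIso i] {a : q ⟶ x} {b : q ⟶ y} {a' : p ⟶ x}
    {b' : p ⟶ y} (ha : i ≫ a = a') (hb : i ≫ b = b') : spanClass δ a' b' = spanClass δ a b := by
  subst ha hb
  rw [spanClass_epi, deg_iso, one_smul]

/-- Pulling back extremal epimorphisms in both legs of a cospan. -/
theorem pullback_epi {p q i j y R R' : A} {e : p ⟶ i} {e' : q ⟶ j} [ExtremalEpi e]
    [ExtremalEpi e'] {b : i ⟶ y} {c : j ⟶ y} {f : R ⟶ p} {g : R ⟶ q} {f' : R' ⟶ i} {g' : R' ⟶ j}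
    (h : R ⟶ R') (hR : IsPullback f g (e ≫ b) (e' ≫ c)) (hR' : IsPullback f' g' b c)
    (h1 : h ≫ f' = f ≫ e) (h2 : h ≫ g' = g ≫ e') :
    ∃ _ : ExtremalEpi h, δ.deg h = δ.deg e * δ.deg e' := by
  have w : (f ≫ e) ≫ b = g ≫ (e' ≫ c) := by simpa using hR.w
  have := KnopRegular.hasPullback_of_commSq _ _ _ _ w
  have hM := IsPullback.of_hasPullback b (e' ≫ c)
  set M := pullback b (e' ≫ c)
  set m1 : M ⟶ i := pullback.fst b (e' ≫ c)
  set m2 : M ⟶ q := pullback.snd b (e' ≫ c)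
  let k : R ⟶ M := hM.lift _ _ w
  have hk1 : k ≫ m1 = f ≫ e := hM.lift_fst _ _ w
  have hk2 : k ≫ m2 = g := hM.lift_snd _ _ w
  let l : M ⟶ R' := hR'.lift m1 (m2 ≫ e') (by simpa using hM.w)
  have hl1 : l ≫ f' = m1 := hR'.lift_fst _ _ _
  have hl2 : l ≫ g' = m2 ≫ e' := hR'.lift_snd _ _ _
  have hkl : k ≫ l = h := by
    apply hR'.hom_ext
    · rw [Category.assoc, hl1, hk1, h1]
    · rw [Category.assoc, hl2, reassoc_of% hk2, h2]
  have sq1 : IsPullback f k e m1 :=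
    (IsPullback.of_right (by rw [hk2]; exact hR.flip) hk1 hM.flip).flip
  have sq2 : IsPullback m2 l e' g' :=
    (IsPullback.of_right (by rw [hl1]; exact hM) hl2 hR').flip
  have hke : ExtremalEpi k := KnopRegular.extremalEpi_of_isPullback sq1 inferInstance
  have hle : ExtremalEpi l := KnopRegular.extremalEpi_of_isPullback sq2 inferInstance
  subst hkl
  refine ⟨inferInstance, ?_⟩
  rw [δ.deg_comp, δ.deg_pullback sq1, δ.deg_pullback sq2, mul_comm]

/-- A representative of a relation. -/
noncomputable def Relation.rep {A : Type u} [Category.{v} A] {x y : A} (r : Relation x y) :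
    RelSpan x y :=
  Quotient.out (s := relSetoid x y) r

theorem Relation.mk_rep {A : Type u} [Category.{v} A] {x y : A} (r : Relation x y) :
    Relation.mk r.rep = r :=
  Quotient.out_eq (s := relSetoid x y) r

theorem Relation.rep_mk {A : Type u} [Category.{v} A] {x y : A} (r : RelSpan x y) :
    ∃ i : (Relation.mk r).rep.apex ≅ r.apex,
      i.hom ≫ r.fst = (Relation.mk r).rep.fst ∧ i.hom ≫ r.snd = (Relation.mk r).rep.snd :=
  Quotient.mk_out (s := relSetoid x y) r

open Classical in
/-- The composite `⟨s⟩ ∘ ⟨r⟩ = δ(e) • ⟨s ⋆ r⟩`, with `s ⋆ r` the image of `r ×_y s → x ⨯ z` and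
`e : r ×_y s ↠ s ⋆ r`, and zero if the fibre product does not exist. -/
noncomputable def compRel {x y z : A} (r : Relation x y) (s : Relation y z) : Relation x z →₀ K :=
  if _h : HasPullback r.rep.snd s.rep.fst then
    spanClass δ (pullback.fst r.rep.snd s.rep.fst ≫ r.rep.fst)
      (pullback.snd r.rep.snd s.rep.fst ≫ s.rep.snd)
  else 0

/-- The bilinear extension of `compRel`. -/
noncomputable def compLin (x y z : A) :
    (Relation x y →₀ K) →ₗ[K] (Relation y z →₀ K) →ₗ[K] (Relation x z →₀ K) :=
  Finsupp.linearCombination K fun r => Finsupp.linearCombination K fun s => compRel δ r s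

theorem compLin_single {x y z : A} (r : Relation x y) (s : Relation y z) (a b : K) :
    compLin δ x y z (Finsupp.single r a) (Finsupp.single s b) = (a * b) • compRel δ r s := by
  simp [compLin, mul_smul]

theorem compRel_mk {x y z R : A} (r : RelSpan x y) (s : RelSpan y z) {f : R ⟶ r.apex}
    {g : R ⟶ s.apex} (h : IsPullback f g r.snd s.fst) :
    compRel δ (Relation.mk r) (Relation.mk s) = spanClass δ (f ≫ r.fst) (g ≫ s.snd) := by
  obtain ⟨i, hi1, hi2⟩ := Relation.rep_mk r
  obtain ⟨j, hj1, hj2⟩ := Relation.rep_mk s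
  have h' : IsPullback (f ≫ i.inv) (g ≫ j.inv) (Relation.mk r).rep.snd (Relation.mk s).rep.fst :=
    h.of_iso (Iso.refl _) i.symm j.symm (Iso.refl _) (by simp) (by simp) (by simp [← hi2])
      (by simp [← hj1])
  have hp := h'.hasPullback
  rw [compRel, dif_pos hp]
  refine spanClass_congr δ (h'.isoPullback).inv ?_ ?_
  · simp [← hi1]
    rw [← reassoc_of% h'.isoPullback_inv_fst]
    simp
  · simp [← hj2]
    rw [← reassoc_of% h'.isoPullback_inv_snd]
    simp

theorem compRel_mk_of_forall {x y z : A} (r : RelSpan x y) (s : RelSpan y z)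
    (h : ∀ (w : A) (f : w ⟶ r.apex) (g : w ⟶ s.apex), f ≫ r.snd ≠ g ≫ s.fst) :
    compRel δ (Relation.mk r) (Relation.mk s) = 0 := by
  obtain ⟨i, hi1, hi2⟩ := Relation.rep_mk r
  obtain ⟨j, hj1, hj2⟩ := Relation.rep_mk s
  rw [compRel, dif_neg]
  intro hp
  refine h _ (pullback.fst (Relation.mk r).rep.snd (Relation.mk s).rep.fst ≫ i.hom)
    (pullback.snd (Relation.mk r).rep.snd (Relation.mk s).rep.fst ≫ j.hom) ?_
  simp only [Category.assoc, hi2, hj1]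
  exact pullback.condition

/-- The composite of two spans is their pullback. -/
theorem compLin_span {x y z P Q R : A} (a : P ⟶ x) {b : P ⟶ y} {c : Q ⟶ y} (d : Q ⟶ z)
    {f : R ⟶ P} {g : R ⟶ Q} (h : IsPullback f g b c) :
    compLin δ x y z (spanClass δ a b) (spanClass δ c d) = spanClass δ (f ≫ a) (g ≫ d) := by
  obtain ⟨r, e, _, rfl, rfl⟩ := exists_factor a b
  obtain ⟨s, e', _, rfl, rfl⟩ := exists_factor c d
  have := KnopRegular.hasPullback_of_commSq (f ≫ e) (g ≫ e') r.snd s.fst (by simpa using h.w)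
  have h' := IsPullback.of_hasPullback r.snd s.fst
  obtain ⟨_, hk⟩ := pullback_epi δ (h'.lift (f ≫ e) (g ≫ e') (by simpa using h.w)) h h'
    (h'.lift_fst _ _ _) (h'.lift_snd _ _ _)
  rw [spanClass_eq_single, spanClass_eq_single, compLin_single, compRel_mk δ r s h', ← hk,
    ← spanClass_epi, h'.lift_fst_assoc, h'.lift_snd_assoc, Category.assoc, Category.assoc]

theorem compLin_span_of_forall {x y z P Q : A} (a : P ⟶ x) {b : P ⟶ y} {c : Q ⟶ y} (d : Q ⟶ z)
    (h : ∀ (w : A) (f : w ⟶ P) (g : w ⟶ Q), f ≫ b ≠ g ≫ c) :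
    compLin δ x y z (spanClass δ a b) (spanClass δ c d) = 0 := by
  obtain ⟨r, e, _, rfl, rfl⟩ := exists_factor a b
  obtain ⟨s, e', _, rfl, rfl⟩ := exists_factor c d
  rw [spanClass_eq_single, spanClass_eq_single, compLin_single, compRel_mk_of_forall, smul_zero]
  intro w f g hfg
  have h1 := KnopRegular.hasPullback_of_extremalEpi e f
  have h2 := KnopRegular.hasPullback_of_extremalEpi e' (pullback.snd e f ≫ g)
  refine h _ (pullback.snd e' (pullback.snd e f ≫ g) ≫ pullback.fst e f)
    (pullback.fst e' (pullback.snd e f ≫ g)) ?_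
  have c1 := pullback.condition (f := e) (g := f)
  have c2 := pullback.condition (f := e') (g := pullback.snd e f ≫ g)
  rw [Category.assoc, reassoc_of% c1, hfg, reassoc_of% c2]

theorem hom_induction {x y : A} {motive : (Relation x y →₀ K) → Prop} (f : Relation x y →₀ K)
    (zero : motive 0) (add : ∀ f g, motive f → motive g → motive (f + g))
    (span : ∀ (k : K) {p : A} (a : p ⟶ x) (b : p ⟶ y), motive (k • spanClass δ a b)) :
    motive f := by
  induction f using Finsupp.induction_linear with
  | zero => exact zero
  | add f g hf hg => exact add f g hf hg
  | single r k =>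
    have := span k r.rep.fst r.rep.snd
    rw [spanClass_rel, Relation.mk_rep] at this
    simpa using this

theorem compLin_id_left {x y : A} (f : Relation x y →₀ K) :
    compLin δ x x y (spanClass δ (𝟙 x) (𝟙 x)) f = f := by
  induction f using hom_induction δ with
  | zero => simp
  | add f g hf hg => rw [map_add, hf, hg]
  | span k a b => rw [map_smul, compLin_span δ _ _ (IsPullback.id_vert a)]; simp

theorem compLin_id_right {x y : A} (f : Relation x y →₀ K) :
    compLin δ x y y f (spanClass δ (𝟙 y) (𝟙 y)) = f := by
  induction f using hom_induction δ with
  | zero => simp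
  | add f g hf hg => rw [map_add, LinearMap.add_apply, hf, hg]
  | span k a b =>
    rw [map_smul, LinearMap.smul_apply, compLin_span δ _ _ (IsPullback.id_horiz b)]
    simp

theorem compLin_assoc_span {x y z t P Q R : A} (a : P ⟶ x) (b : P ⟶ y) (c : Q ⟶ y) (d : Q ⟶ z)
    (e : R ⟶ z) (f : R ⟶ t) :
    compLin δ x z t (compLin δ x y z (spanClass δ a b) (spanClass δ c d)) (spanClass δ e f) =
      compLin δ x y t (spanClass δ a b) (compLin δ y z t (spanClass δ c d) (spanClass δ e f)) := by
  by_cases hw : ∃ (w : A) (p : w ⟶ P) (q : w ⟶ Q) (r : w ⟶ R), p ≫ b = q ≫ c ∧ q ≫ d = r ≫ e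
  · obtain ⟨w, p, q, r, h1, h2⟩ := hw
    have := KnopRegular.hasPullback_of_commSq _ _ _ _ h1
    have := KnopRegular.hasPullback_of_commSq _ _ _ _ h2
    have hl := IsPullback.of_hasPullback b c
    have hr := IsPullback.of_hasPullback d e
    have := KnopRegular.hasPullback_of_commSq (pullback.lift _ _ h1) (pullback.lift _ _ h2)
      (pullback.snd b c) (pullback.fst d e) (by simp [pullback.lift_fst, pullback.lift_snd])
    have ht := IsPullback.of_hasPullback (pullback.snd b c) (pullback.fst d e)
    rw [compLin_span δ a d hl, compLin_span δ c f hr, compLin_span δ _ f (ht.flip.paste_horiz hr.flip).flip,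
      compLin_span δ a _ (ht.paste_horiz hl)]
    simp
  · push Not at hw
    trans 0
    · by_cases h : HasPullback b c
      · rw [compLin_span δ a d (IsPullback.of_hasPullback b c), compLin_span_of_forall]
        intro w f g h
        exact hw w (f ≫ pullback.fst b c) (f ≫ pullback.snd b c) g (by simp [pullback.condition])
          (by simpa using h)
      · rw [compLin_span_of_forall, map_zero, LinearMap.zero_apply]
        intro w f g hfg
        exact h (KnopRegular.hasPullback_of_commSq _ _ _ _ hfg)
    · symm
      by_cases h : HasPullback d e
      · rw [compLin_span δ c f (IsPullback.of_hasPullback d e), compLin_span_of_forall]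
        intro w f g h
        exact hw w f (g ≫ pullback.fst d e) (g ≫ pullback.snd d e) (by simpa using h)
          (by simp [pullback.condition])
      · rw [compLin_span_of_forall δ c f, map_zero]
        intro w f g hfg
        exact h (KnopRegular.hasPullback_of_commSq _ _ _ _ hfg)

theorem compLin_assoc {x y z t : A} (f : Relation x y →₀ K) (g : Relation y z →₀ K)
    (h : Relation z t →₀ K) :
    compLin δ x z t (compLin δ x y z f g) h = compLin δ x y t f (compLin δ y z t g h) := by
  induction f using hom_induction δ with
  | zero => simp
  | add f f' hf hf' => simp only [map_add, LinearMap.add_apply, hf, hf']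
  | span k a b =>
    induction g using hom_induction δ with
    | zero => simp
    | add f f' hf hf' => simp only [map_add, LinearMap.add_apply, hf, hf']
    | span l c d =>
      induction h using hom_induction δ with
      | zero => simp
      | add f f' hf hf' => simp only [map_add, hf, hf']
      | span m e f => simp only [map_smul, LinearMap.smul_apply, compLin_assoc_span]

end SpanCalculus

/-- Knop's category `T⁰(A, δ)`: its objects are those of `A`, its morphisms are the formal linear
combinations of relations, with composition twisted by `δ`. -/
structure T0 {A : Type u} [Category.{v} A] {K : Type w} [CommRing K] (δ : DegreeFunction A K) where
  of ::
  obj : A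

section T0

variable {A : Type u} [Category.{v} A] [KnopRegular A] {K : Type w} [CommRing K]
  {δ : DegreeFunction A K}

noncomputable instance : Category.{max w u v} (T0 δ) where
  Hom X Y := Relation X.obj Y.obj →₀ K
  id X := spanClass δ (𝟙 X.obj) (𝟙 X.obj)
  comp f g := compLin δ _ _ _ f g
  id_comp f := compLin_id_left δ f
  comp_id f := compLin_id_right δ f
  assoc f g h := compLin_assoc δ f g h

noncomputable instance : Preadditive (T0 δ) where
  homGroup X Y := inferInstanceAs (AddCommGroup (Relation X.obj Y.obj →₀ K))
  add_comp X Y Z f f' g :=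
    LinearMap.map_add₂ (compLin δ X.obj Y.obj Z.obj) (f : Relation X.obj Y.obj →₀ K) f' g
  comp_add X Y Z f g g' :=
    (LinearMap.map_add (compLin δ X.obj Y.obj Z.obj f) g g' :)

noncomputable instance : Linear K (T0 δ) where
  homModule X Y := inferInstanceAs (Module K (Relation X.obj Y.obj →₀ K))
  smul_comp X Y Z k f g :=
    LinearMap.map_smul₂ (compLin δ X.obj Y.obj Z.obj) k (f : Relation X.obj Y.obj →₀ K) g
  comp_smul X Y Z f k g :=
    (LinearMap.map_smul (compLin δ X.obj Y.obj Z.obj f) k g :)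

end T0

section Tensor

variable {A : Type u} [Category.{v} A] [KnopRegular A] {K : Type w} [CommRing K]
  (δ : DegreeFunction A K)

theorem isPullback_of_terminal (P Q : A) [HasBinaryProduct P Q] :
    IsPullback (prod.fst : P ⨯ Q ⟶ P) prod.snd (terminal.from P) (terminal.from Q) :=
  IsPullback.of_hasBinaryProduct' P Q

theorem isPullback_prodMap {P Q R y P' Q' R' y' : A} {f : R ⟶ P} {g : R ⟶ Q} {b : P ⟶ y}
    {c : Q ⟶ y} {f' : R' ⟶ P'} {g' : R' ⟶ Q'} {b' : P' ⟶ y'} {c' : Q' ⟶ y'}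
    [HasBinaryProduct P P'] [HasBinaryProduct Q Q'] [HasBinaryProduct R R']
    [HasBinaryProduct y y'] (h : IsPullback f g b c) (h' : IsPullback f' g' b' c') :
    IsPullback (prod.map f f') (prod.map g g') (prod.map b b') (prod.map c c') := by
  refine IsPullback.mk' ?_ ?_ ?_
  · ext <;> simp [h.w, h'.w]
  · intro T φ φ' h1 h2
    have h11 := h1 =≫ prod.fst
    have h12 := h1 =≫ prod.snd
    have h21 := h2 =≫ prod.fst
    have h22 := h2 =≫ prod.snd
    simp only [Category.assoc, prod.map_fst, prod.map_snd] at h11 h12 h21 h22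
    ext
    · exact h.hom_ext (by simpa using h11) (by simpa using h21)
    · exact h'.hom_ext (by simpa using h12) (by simpa using h22)
  · intro T a b hab
    have h1 := hab =≫ prod.fst
    have h2 := hab =≫ prod.snd
    simp only [Category.assoc, prod.map_fst, prod.map_snd] at h1 h2
    refine ⟨prod.lift (h.lift (a ≫ prod.fst) (b ≫ prod.fst) (by simpa using h1))
      (h'.lift (a ≫ prod.snd) (b ≫ prod.snd) (by simpa using h2)), ?_, ?_⟩ <;> ext <;>
      simp [prod.lift_fst, prod.lift_snd]

open Classical in
/-- The product `r × r' ⊆ (x ⨯ x') ⨯ (y ⨯ y')` of two relations `r ⊆ x ⨯ y` and `r' ⊆ x' ⨯ y'`,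
and zero if it does not exist. -/
noncomputable def tensRel {x y x' y' : A} [HasBinaryProduct x x'] [HasBinaryProduct y y']
    (r : Relation x y) (r' : Relation x' y') : Relation (x ⨯ x') (y ⨯ y') →₀ K :=
  if _h : HasBinaryProduct r.rep.apex r'.rep.apex then
    spanClass δ (prod.map r.rep.fst r'.rep.fst) (prod.map r.rep.snd r'.rep.snd)
  else 0

/-- The bilinear extension of `tensRel`. -/
noncomputable def tensLin (x y x' y' : A) [HasBinaryProduct x x'] [HasBinaryProduct y y'] :
    (Relation x y →₀ K) →ₗ[K] (Relation x' y' →₀ K) →ₗ[K] (Relation (x ⨯ x') (y ⨯ y') →₀ K) :=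
  Finsupp.linearCombination K fun r => Finsupp.linearCombination K fun s => tensRel δ r s

theorem tensLin_single {x y x' y' : A} [HasBinaryProduct x x'] [HasBinaryProduct y y']
    (r : Relation x y) (s : Relation x' y') (a b : K) :
    tensLin δ x y x' y' (Finsupp.single r a) (Finsupp.single s b) = (a * b) • tensRel δ r s := by
  simp [tensLin, mul_smul]

theorem tensRel_mk {x y x' y' : A} [HasBinaryProduct x x'] [HasBinaryProduct y y']
    (r : RelSpan x y) (r' : RelSpan x' y') [HasBinaryProduct r.apex r'.apex] :
    tensRel δ (Relation.mk r) (Relation.mk r') =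
      spanClass δ (prod.map r.fst r'.fst) (prod.map r.snd r'.snd) := by
  obtain ⟨i, hi1, hi2⟩ := Relation.rep_mk r
  obtain ⟨j, hj1, hj2⟩ := Relation.rep_mk r'
  have hp : HasBinaryProduct (Relation.mk r).rep.apex (Relation.mk r').rep.apex :=
    hasBinaryProduct_of_maps (w := r.apex ⨯ r'.apex) (prod.fst ≫ i.inv) (prod.snd ≫ j.inv)
  rw [tensRel, dif_pos hp]
  have hk : IsIso (prod.map i.hom j.hom) := ⟨prod.map i.inv j.inv, by ext <;> simp, by ext <;> simp⟩
  refine spanClass_congr δ (prod.map i.hom j.hom) ?_ ?_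
  · ext <;> simp [hi1, hj1]
  · ext <;> simp [hi2, hj2]

theorem tensRel_mk_of_forall {x y x' y' : A} [HasBinaryProduct x x'] [HasBinaryProduct y y']
    (r : RelSpan x y) (r' : RelSpan x' y')
    (h : ∀ (w : A) (_ : w ⟶ r.apex) (_ : w ⟶ r'.apex), False) :
    tensRel δ (Relation.mk r) (Relation.mk r') = 0 := by
  obtain ⟨i, -, -⟩ := Relation.rep_mk r
  obtain ⟨j, -, -⟩ := Relation.rep_mk r'
  rw [tensRel, dif_neg]
  intro hp
  exact h _ ((prod.fst : (Relation.mk r).rep.apex ⨯ (Relation.mk r').rep.apex ⟶ _) ≫ i.hom)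
    (prod.snd ≫ j.hom)

/-- The tensor product of two spans is their product. -/
theorem tensLin_span {x y x' y' P P' : A} [HasBinaryProduct x x'] [HasBinaryProduct y y']
    [HasBinaryProduct P P'] (a : P ⟶ x) (b : P ⟶ y) (a' : P' ⟶ x') (b' : P' ⟶ y') :
    tensLin δ x y x' y' (spanClass δ a b) (spanClass δ a' b') =
      spanClass δ (prod.map a a') (prod.map b b') := by
  obtain ⟨r, e, _, rfl, rfl⟩ := exists_factor a b
  obtain ⟨s, e', _, rfl, rfl⟩ := exists_factor a' b'
  have : HasBinaryProduct r.apex s.apex :=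
    hasBinaryProduct_of_maps (w := P ⨯ P') (prod.fst ≫ e) (prod.snd ≫ e')
  have h : IsPullback (prod.fst : P ⨯ P' ⟶ P) prod.snd (e ≫ terminal.from r.apex)
      (e' ≫ terminal.from s.apex) := by
    rw [terminal.comp_from, terminal.comp_from]
    exact isPullback_of_terminal P P'
  obtain ⟨_, hk⟩ := pullback_epi δ (prod.map e e') h (isPullback_of_terminal r.apex s.apex)
    (prod.map_fst _ _) (prod.map_snd _ _)
  rw [spanClass_eq_single, spanClass_eq_single, tensLin_single, tensRel_mk δ r s, ← hk,
    ← spanClass_epi, prod.map_map, prod.map_map]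

theorem tensLin_span_of_forall {x y x' y' P P' : A} [HasBinaryProduct x x'] [HasBinaryProduct y y']
    (a : P ⟶ x) (b : P ⟶ y) (a' : P' ⟶ x') (b' : P' ⟶ y')
    (h : ∀ (w : A) (_ : w ⟶ P) (_ : w ⟶ P'), False) :
    tensLin δ x y x' y' (spanClass δ a b) (spanClass δ a' b') = 0 := by
  obtain ⟨r, e, _, rfl, rfl⟩ := exists_factor a b
  obtain ⟨s, e', _, rfl, rfl⟩ := exists_factor a' b'
  rw [spanClass_eq_single, spanClass_eq_single, tensLin_single, tensRel_mk_of_forall, smul_zero]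
  intro w f g
  have h1 := KnopRegular.hasPullback_of_extremalEpi e f
  have h2 := KnopRegular.hasPullback_of_extremalEpi e' (pullback.snd e f ≫ g)
  exact h _ (pullback.snd e' (pullback.snd e f ≫ g) ≫ pullback.fst e f)
    (pullback.fst e' (pullback.snd e f ≫ g))

theorem tensLin_comp_span {x y z x' y' z' P Q P' Q' : A} [HasBinaryProduct x x']
    [HasBinaryProduct y y'] [HasBinaryProduct z z'] (a : P ⟶ x) (b : P ⟶ y) (c : Q ⟶ y) (d : Q ⟶ z)
    (a' : P' ⟶ x') (b' : P' ⟶ y') (c' : Q' ⟶ y') (d' : Q' ⟶ z') :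
    tensLin δ x z x' z' (compLin δ x y z (spanClass δ a b) (spanClass δ c d))
        (compLin δ x' y' z' (spanClass δ a' b') (spanClass δ c' d')) =
      compLin δ (x ⨯ x') (y ⨯ y') (z ⨯ z')
        (tensLin δ x y x' y' (spanClass δ a b) (spanClass δ a' b'))
        (tensLin δ y z y' z' (spanClass δ c d) (spanClass δ c' d')) := by
  by_cases hw : ∃ (w : A) (p : w ⟶ P) (q : w ⟶ Q) (p' : w ⟶ P') (q' : w ⟶ Q'),
      p ≫ b = q ≫ c ∧ p' ≫ b' = q' ≫ c'
  · obtain ⟨w, p, q, p', q', h1, h2⟩ := hw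
    have := KnopRegular.hasPullback_of_commSq _ _ _ _ h1
    have := KnopRegular.hasPullback_of_commSq _ _ _ _ h2
    have hl := IsPullback.of_hasPullback b c
    have hr := IsPullback.of_hasPullback b' c'
    have := hasBinaryProduct_of_maps (pullback.lift _ _ h1) (pullback.lift _ _ h2)
    have := hasBinaryProduct_of_maps p p'
    have := hasBinaryProduct_of_maps q q'
    rw [compLin_span δ a d hl, compLin_span δ a' d' hr, tensLin_span, tensLin_span, tensLin_span,
      compLin_span δ _ _ (isPullback_prodMap hl hr), prod.map_map, prod.map_map]
  · push Not at hw
    trans 0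
    · by_cases h : HasPullback b c
      · by_cases h' : HasPullback b' c'
        · rw [compLin_span δ a d (IsPullback.of_hasPullback b c),
            compLin_span δ a' d' (IsPullback.of_hasPullback b' c'), tensLin_span_of_forall]
          intro w f g
          exact hw w (f ≫ pullback.fst b c) (f ≫ pullback.snd b c) (g ≫ pullback.fst b' c')
            (g ≫ pullback.snd b' c') (by simp [pullback.condition]) (by simp [pullback.condition])
        · rw [compLin_span_of_forall δ a', map_zero]
          intro w f g hfg
          exact h' (KnopRegular.hasPullback_of_commSq _ _ _ _ hfg)
      · rw [compLin_span_of_forall δ a, map_zero, LinearMap.zero_apply]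
        intro w f g hfg
        exact h (KnopRegular.hasPullback_of_commSq _ _ _ _ hfg)
    · symm
      by_cases h : HasBinaryProduct P P'
      · by_cases h' : HasBinaryProduct Q Q'
        · rw [tensLin_span, tensLin_span, compLin_span_of_forall]
          intro w f g hfg
          have h1 := hfg =≫ prod.fst
          have h2 := hfg =≫ prod.snd
          simp only [Category.assoc, prod.map_fst, prod.map_snd] at h1 h2
          exact hw w (f ≫ prod.fst) (g ≫ prod.fst) (f ≫ prod.snd) (g ≫ prod.snd)
            (by simpa using h1) (by simpa using h2)
        · rw [tensLin_span_of_forall δ c, map_zero]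
          intro w f g
          exact h' (hasBinaryProduct_of_maps f g)
      · rw [tensLin_span_of_forall δ a, map_zero, LinearMap.zero_apply]
        intro w f g
        exact h (hasBinaryProduct_of_maps f g)

/-- If `y ⨯ y'` does not exist, the tensor product of two composites through `y` and `y'` is
zero. -/
theorem tensLin_comp_span_eq_zero {x y z x' y' z' P Q P' Q' : A} [HasBinaryProduct x x']
    [HasBinaryProduct z z'] (h : ¬ HasBinaryProduct y y')
    (a : P ⟶ x) (b : P ⟶ y) (c : Q ⟶ y) (d : Q ⟶ z)
    (a' : P' ⟶ x') (b' : P' ⟶ y') (c' : Q' ⟶ y') (d' : Q' ⟶ z') :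
    tensLin δ x z x' z' (compLin δ x y z (spanClass δ a b) (spanClass δ c d))
        (compLin δ x' y' z' (spanClass δ a' b') (spanClass δ c' d')) = 0 := by
  by_cases h1 : HasPullback b c
  · by_cases h2 : HasPullback b' c'
    · rw [compLin_span δ a d (IsPullback.of_hasPullback b c),
        compLin_span δ a' d' (IsPullback.of_hasPullback b' c'), tensLin_span_of_forall]
      intro w f g
      exact h (hasBinaryProduct_of_maps (f ≫ pullback.fst b c ≫ b) (g ≫ pullback.fst b' c' ≫ b'))
    · rw [compLin_span_of_forall δ a', map_zero]
      intro w f g hfg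
      exact h2 (KnopRegular.hasPullback_of_commSq _ _ _ _ hfg)
  · rw [compLin_span_of_forall δ a, map_zero, LinearMap.zero_apply]
    intro w f g hfg
    exact h1 (KnopRegular.hasPullback_of_commSq _ _ _ _ hfg)

theorem compLin_span_graph {x y z P : A} (a : P ⟶ x) (b : P ⟶ y) (f : y ⟶ z) :
    compLin δ x y z (spanClass δ a b) (spanClass δ (𝟙 y) f) = spanClass δ a (b ≫ f) := by
  rw [compLin_span δ _ _ (IsPullback.id_horiz b), Category.id_comp]

theorem compLin_graph_span {x y z P : A} (f : x ⟶ y) (g : y ⟶ x) (h : f ≫ g = 𝟙 x) (h' : g ≫ f = 𝟙 y)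
    (a : P ⟶ y) (b : P ⟶ z) :
    compLin δ x y z (spanClass δ (𝟙 x) f) (spanClass δ a b) = spanClass δ (a ≫ g) b := by
  have : IsIso f := ⟨g, h, h'⟩
  have hp : IsPullback (a ≫ g) (𝟙 P) f a := IsPullback.of_vert_isIso ⟨by simp [h']⟩
  rw [compLin_span δ _ _ hp, Category.comp_id, Category.id_comp]

end Tensor

section Coherence

variable {A : Type u} [Category.{v} A]

/-- The associator of binary products. -/
noncomputable def assocHom (x y z : A) [HasBinaryProduct x y] [HasBinaryProduct (x ⨯ y) z]
    [HasBinaryProduct y z] [HasBinaryProduct x (y ⨯ z)] : (x ⨯ y) ⨯ z ⟶ x ⨯ (y ⨯ z) :=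
  prod.lift (prod.fst ≫ prod.fst) (prod.lift (prod.fst ≫ prod.snd) prod.snd)

/-- The inverse of the associator of binary products. -/
noncomputable def assocInv (x y z : A) [HasBinaryProduct x y] [HasBinaryProduct (x ⨯ y) z]
    [HasBinaryProduct y z] [HasBinaryProduct x (y ⨯ z)] : x ⨯ (y ⨯ z) ⟶ (x ⨯ y) ⨯ z :=
  prod.lift (prod.lift prod.fst (prod.snd ≫ prod.fst)) (prod.snd ≫ prod.snd)

theorem assocHom_inv (x y z : A) [HasBinaryProduct x y] [HasBinaryProduct (x ⨯ y) z]
    [HasBinaryProduct y z] [HasBinaryProduct x (y ⨯ z)] :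
    assocHom x y z ≫ assocInv x y z = 𝟙 _ := by
  unfold assocHom assocInv
  ext <;> simp [prod.lift_fst, prod.lift_snd, prod.lift_fst_assoc, prod.lift_snd_assoc]

theorem assocInv_hom (x y z : A) [HasBinaryProduct x y] [HasBinaryProduct (x ⨯ y) z]
    [HasBinaryProduct y z] [HasBinaryProduct x (y ⨯ z)] :
    assocInv x y z ≫ assocHom x y z = 𝟙 _ := by
  unfold assocHom assocInv
  ext <;> simp [prod.lift_fst, prod.lift_snd, prod.lift_fst_assoc, prod.lift_snd_assoc]

theorem assocHom_naturality {x y z x' y' z' : A} [HasBinaryProduct x y]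
    [HasBinaryProduct (x ⨯ y) z] [HasBinaryProduct y z] [HasBinaryProduct x (y ⨯ z)]
    [HasBinaryProduct x' y'] [HasBinaryProduct (x' ⨯ y') z'] [HasBinaryProduct y' z']
    [HasBinaryProduct x' (y' ⨯ z')] (f : x ⟶ x') (g : y ⟶ y') (h : z ⟶ z') :
    prod.map (prod.map f g) h ≫ assocHom x' y' z' = assocHom x y z ≫ prod.map f (prod.map g h) := by
  unfold assocHom
  ext <;> simp [prod.lift_fst, prod.lift_snd, prod.lift_fst_assoc, prod.lift_snd_assoc]

end Coherence

namespace T0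

variable {A : Type u} [Category.{v} A] [KnopRegular A] {K : Type w} [CommRing K]
  {δ : DegreeFunction A K}

/-- The morphism `⟨Γ f⟩` given by the graph of `f`. -/
noncomputable def graph {X Y : T0 δ} (f : X.obj ⟶ Y.obj) : X ⟶ Y := spanClass δ (𝟙 X.obj) f

/-- The tensor product of morphisms, on those pairs of objects whose product exists. -/
noncomputable def tens (X Y X' Y' : T0 δ) [HasBinaryProduct X.obj X'.obj]
    [HasBinaryProduct Y.obj Y'.obj] :
    (X ⟶ Y) →ₗ[K] (X' ⟶ Y') →ₗ[K] (T0.of (δ := δ) (X.obj ⨯ X'.obj) ⟶ T0.of (Y.obj ⨯ Y'.obj)) :=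
  tensLin δ X.obj Y.obj X'.obj Y'.obj

theorem graph_id (X : T0 δ) : graph (𝟙 X.obj) = 𝟙 X := rfl

theorem graph_comp {X Y Z : T0 δ} (f : X.obj ⟶ Y.obj) (g : Y.obj ⟶ Z.obj) :
    (graph f : X ⟶ Y) ≫ (graph g : Y ⟶ Z) = graph (f ≫ g) :=
  compLin_span_graph δ _ _ _

theorem tens_graph {X Y X' Y' : T0 δ} [HasBinaryProduct X.obj X'.obj]
    [HasBinaryProduct Y.obj Y'.obj] (f : X.obj ⟶ Y.obj) (g : X'.obj ⟶ Y'.obj) :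
    tens X Y X' Y' (graph f) (graph g) = graph (prod.map f g) := by
  refine (tensLin_span δ _ _ _ _).trans ?_
  rw [prod.map_id_id]
  rfl

theorem induction {X Y : T0 δ} {motive : (X ⟶ Y) → Prop} (f : X ⟶ Y)
    (zero : motive 0) (add : ∀ f g, motive f → motive g → motive (f + g))
    (smul : ∀ (k : K) f, motive f → motive (k • f))
    (span : ∀ {p : A} (a : p ⟶ X.obj) (b : p ⟶ Y.obj), motive (spanClass δ a b : X ⟶ Y)) :
    motive f :=
  hom_induction δ f zero add fun k _ a b => smul k _ (span a b)

theorem tens_comp {X Y Z X' Y' Z' : T0 δ} [HasBinaryProduct X.obj X'.obj]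
    [HasBinaryProduct Y.obj Y'.obj] [HasBinaryProduct Z.obj Z'.obj] (f : X ⟶ Y) (g : Y ⟶ Z)
    (f' : X' ⟶ Y') (g' : Y' ⟶ Z') :
    tens X Z X' Z' (f ≫ g) (f' ≫ g') = tens X Y X' Y' f f' ≫ tens Y Z Y' Z' g g' := by
  induction f using T0.induction with
  | zero => simp
  | add f₁ f₂ h₁ h₂ => simp only [Preadditive.add_comp, map_add, LinearMap.add_apply, h₁, h₂]
  | smul k f h => simp only [map_smul, LinearMap.smul_apply, Linear.smul_comp, Linear.comp_smul, h]
  | span a b =>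
    induction g using T0.induction with
    | zero => simp
    | add f₁ f₂ h₁ h₂ => simp only [Preadditive.comp_add, map_add, LinearMap.add_apply, h₁, h₂]
    | smul k f h => simp only [map_smul, LinearMap.smul_apply, Linear.smul_comp, Linear.comp_smul, h]
    | span c d =>
      induction f' using T0.induction with
      | zero => simp
      | add f₁ f₂ h₁ h₂ => simp only [Preadditive.add_comp, map_add, h₁, h₂]
      | smul k f h => simp only [map_smul, LinearMap.smul_apply, Linear.smul_comp, Linear.comp_smul, h]
      | span a' b' =>
        induction g' using T0.induction with
        | zero => simp
        | add f₁ f₂ h₁ h₂ => simp only [Preadditive.comp_add, map_add, h₁, h₂]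
        | smul k f h => simp only [map_smul, LinearMap.smul_apply, Linear.smul_comp, Linear.comp_smul, h]
        | span c' d' => exact tensLin_comp_span δ a b c d a' b' c' d'

theorem tens_comp_eq_zero {X Y Z X' Y' Z' : T0 δ} [HasBinaryProduct X.obj X'.obj]
    [HasBinaryProduct Z.obj Z'.obj] (hY : ¬ HasBinaryProduct Y.obj Y'.obj) (f : X ⟶ Y) (g : Y ⟶ Z)
    (f' : X' ⟶ Y') (g' : Y' ⟶ Z') :
    tens X Z X' Z' (f ≫ g) (f' ≫ g') = 0 := by
  induction f using T0.induction with
  | zero => simp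
  | add f₁ f₂ h₁ h₂ =>
    simp only [Preadditive.add_comp, map_add, LinearMap.add_apply, h₁, h₂, add_zero]
  | smul k f h => simp only [map_smul, LinearMap.smul_apply, Linear.smul_comp, Linear.comp_smul, h, smul_zero]
  | span a b =>
    induction g using T0.induction with
    | zero => simp
    | add f₁ f₂ h₁ h₂ =>
      simp only [Preadditive.comp_add, map_add, LinearMap.add_apply, h₁, h₂, add_zero]
    | smul k f h => simp only [map_smul, LinearMap.smul_apply, Linear.smul_comp, Linear.comp_smul, h, smul_zero]
    | span c d =>
      induction f' using T0.induction with
      | zero => simp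
      | add f₁ f₂ h₁ h₂ => simp only [Preadditive.add_comp, map_add, h₁, h₂, add_zero]
      | smul k f h => simp only [map_smul, LinearMap.smul_apply, Linear.smul_comp, Linear.comp_smul, h, smul_zero]
      | span a' b' =>
        induction g' using T0.induction with
        | zero => simp
        | add f₁ f₂ h₁ h₂ => simp only [Preadditive.comp_add, map_add, h₁, h₂, add_zero]
        | smul k f h => simp only [map_smul, LinearMap.smul_apply, Linear.smul_comp, Linear.comp_smul, h, smul_zero]
        | span c' d' => exact tensLin_comp_span_eq_zero δ hY a b c d a' b' c' d'

theorem assoc_naturality {X Y X' Y' X'' Y'' : T0 δ} [HasBinaryProduct X.obj X'.obj]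
    [HasBinaryProduct (X.obj ⨯ X'.obj) X''.obj] [HasBinaryProduct X'.obj X''.obj]
    [HasBinaryProduct X.obj (X'.obj ⨯ X''.obj)] [HasBinaryProduct Y.obj Y'.obj]
    [HasBinaryProduct (Y.obj ⨯ Y'.obj) Y''.obj] [HasBinaryProduct Y'.obj Y''.obj]
    [HasBinaryProduct Y.obj (Y'.obj ⨯ Y''.obj)] (f : X ⟶ Y) (f' : X' ⟶ Y') (f'' : X'' ⟶ Y'') :
    tens (T0.of (X.obj ⨯ X'.obj)) (T0.of (Y.obj ⨯ Y'.obj)) X'' Y'' (tens X Y X' Y' f f') f'' ≫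
        graph (assocHom Y.obj Y'.obj Y''.obj) =
      graph (assocHom X.obj X'.obj X''.obj) ≫
        tens X Y (T0.of (X'.obj ⨯ X''.obj)) (T0.of (Y'.obj ⨯ Y''.obj)) f
          (tens X' Y' X'' Y'' f' f'') := by
  induction f using T0.induction with
  | zero => simp
  | add f₁ f₂ h₁ h₂ =>
    simp only [Preadditive.add_comp, Preadditive.comp_add, map_add, LinearMap.add_apply, h₁, h₂]
  | smul k f h =>
    simp only [map_smul, LinearMap.smul_apply, Linear.smul_comp, Linear.comp_smul, h]
  | span a b =>
    induction f' using T0.induction with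
    | zero => simp
    | add f₁ f₂ h₁ h₂ =>
      simp only [Preadditive.add_comp, Preadditive.comp_add, map_add, LinearMap.add_apply, h₁, h₂]
    | smul k f h =>
      simp only [map_smul, LinearMap.smul_apply, Linear.smul_comp, Linear.comp_smul, h]
    | span a' b' =>
      induction f'' using T0.induction with
      | zero => simp
      | add f₁ f₂ h₁ h₂ => simp only [Preadditive.add_comp, Preadditive.comp_add, map_add, h₁, h₂]
      | smul k f h =>
        simp only [map_smul, LinearMap.smul_apply, Linear.smul_comp, Linear.comp_smul, h]
      | span a'' b'' =>
        rename_i P P' P''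
        change compLin δ _ _ _ (tensLin δ _ _ _ _ (tensLin δ _ _ _ _ (spanClass δ a b)
          (spanClass δ a' b')) (spanClass δ a'' b'')) (spanClass δ _ _) = compLin δ _ _ _
          (spanClass δ _ _) (tensLin δ _ _ _ _ (spanClass δ a b) (tensLin δ _ _ _ _
          (spanClass δ a' b') (spanClass δ a'' b'')))
        by_cases hw : ∃ (w : A), Nonempty (w ⟶ P) ∧ Nonempty (w ⟶ P') ∧ Nonempty (w ⟶ P'')
        · obtain ⟨w, ⟨p⟩, ⟨p'⟩, ⟨p''⟩⟩ := hw
          have := hasBinaryProduct_of_maps p p'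
          have := hasBinaryProduct_of_maps p' p''
          have := hasBinaryProduct_of_maps (prod.lift p p') p''
          have := hasBinaryProduct_of_maps p (prod.lift p' p'')
          rw [tensLin_span, tensLin_span, tensLin_span, tensLin_span, compLin_span_graph,
            compLin_graph_span δ _ _ (assocHom_inv _ _ _) (assocInv_hom _ _ _)]
          have : IsIso (assocHom P P' P'') := ⟨assocInv P P' P'', assocHom_inv _ _ _, assocInv_hom _ _ _⟩
          refine spanClass_congr δ (assocHom P P' P'') ?_ ?_
          · rw [← Category.assoc, ← assocHom_naturality, Category.assoc, assocHom_inv,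
              Category.comp_id]
          · rw [assocHom_naturality]
        · trans 0
          · by_cases h : HasBinaryProduct P P'
            · rw [tensLin_span, tensLin_span_of_forall, map_zero, LinearMap.zero_apply]
              intro w f g
              exact hw ⟨w, ⟨f ≫ prod.fst⟩, ⟨f ≫ prod.snd⟩, ⟨g⟩⟩
            · rw [tensLin_span_of_forall δ a b a' b', map_zero, LinearMap.zero_apply, map_zero,
                LinearMap.zero_apply]
              intro w f g
              exact h (hasBinaryProduct_of_maps f g)
          · symm
            by_cases h : HasBinaryProduct P' P''
            · rw [tensLin_span, tensLin_span_of_forall, map_zero]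
              intro w f g
              exact hw ⟨w, ⟨f⟩, ⟨g ≫ prod.fst⟩, ⟨g ≫ prod.snd⟩⟩
            · rw [tensLin_span_of_forall δ a' b', map_zero, map_zero]
              intro w f g
              exact h (hasBinaryProduct_of_maps f g)

theorem leftUnitor_naturality {X Y : T0 δ} [HasBinaryProduct (⊤_ A) X.obj]
    [HasBinaryProduct (⊤_ A) Y.obj] (f : X ⟶ Y) :
    tens (T0.of (⊤_ A)) (T0.of (⊤_ A)) X Y (𝟙 _) f ≫ graph (Y := Y) prod.snd =
      graph (X := T0.of ((⊤_ A) ⨯ X.obj)) prod.snd ≫ f := by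
  induction f using T0.induction with
  | zero => simp
  | add f₁ f₂ h₁ h₂ => simp only [Preadditive.add_comp, Preadditive.comp_add, map_add, h₁, h₂]
  | smul k f h =>
    simp only [map_smul, LinearMap.smul_apply, Linear.smul_comp, Linear.comp_smul, h]
  | span a b =>
    rename_i P
    change compLin δ _ _ _ (tensLin δ _ _ _ _ (spanClass δ (𝟙 _) (𝟙 _)) (spanClass δ a b))
      (spanClass δ _ _) = compLin δ _ _ _ (spanClass δ _ _) (spanClass δ a b)
    have := hasBinaryProduct_of_maps (terminal.from P) (𝟙 P)
    have h1 : ∀ (x : A) [HasBinaryProduct (⊤_ A) x],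
        (prod.snd : (⊤_ A) ⨯ x ⟶ x) ≫ prod.lift (terminal.from x) (𝟙 x) = 𝟙 _ := by
      intro x _
      ext
      simp [prod.lift_snd]
    have h2 : ∀ (x : A) [HasBinaryProduct (⊤_ A) x],
        prod.lift (terminal.from x) (𝟙 x) ≫ (prod.snd : (⊤_ A) ⨯ x ⟶ x) = 𝟙 _ := by
      intro x _
      simp [prod.lift_snd]
    rw [tensLin_span, compLin_span_graph, compLin_graph_span δ _ _ (h1 _) (h2 _)]
    have : IsIso (prod.snd : (⊤_ A) ⨯ P ⟶ P) := ⟨_, h1 _, h2 _⟩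
    refine spanClass_congr δ (prod.snd : (⊤_ A) ⨯ P ⟶ P) ?_ (by simp)
    ext
    simp [prod.lift_snd]

theorem rightUnitor_naturality {X Y : T0 δ} [HasBinaryProduct X.obj (⊤_ A)]
    [HasBinaryProduct Y.obj (⊤_ A)] (f : X ⟶ Y) :
    tens X Y (T0.of (⊤_ A)) (T0.of (⊤_ A)) f (𝟙 _) ≫ graph (Y := Y) prod.fst =
      graph (X := T0.of (X.obj ⨯ ⊤_ A)) prod.fst ≫ f := by
  induction f using T0.induction with
  | zero => simp
  | add f₁ f₂ h₁ h₂ =>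
    simp only [Preadditive.add_comp, Preadditive.comp_add, map_add, LinearMap.add_apply, h₁, h₂]
  | smul k f h =>
    simp only [map_smul, LinearMap.smul_apply, Linear.smul_comp, Linear.comp_smul, h]
  | span a b =>
    rename_i P
    change compLin δ _ _ _ (tensLin δ _ _ _ _ (spanClass δ a b) (spanClass δ (𝟙 _) (𝟙 _)))
      (spanClass δ _ _) = compLin δ _ _ _ (spanClass δ _ _) (spanClass δ a b)
    have := hasBinaryProduct_of_maps (𝟙 P) (terminal.from P)
    have h1 : ∀ (x : A) [HasBinaryProduct x (⊤_ A)],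
        (prod.fst : x ⨯ (⊤_ A) ⟶ x) ≫ prod.lift (𝟙 x) (terminal.from x) = 𝟙 _ := by
      intro x _
      ext
      simp [prod.lift_fst]
    have h2 : ∀ (x : A) [HasBinaryProduct x (⊤_ A)],
        prod.lift (𝟙 x) (terminal.from x) ≫ (prod.fst : x ⨯ (⊤_ A) ⟶ x) = 𝟙 _ := by
      intro x _
      simp [prod.lift_fst]
    rw [tensLin_span, compLin_span_graph, compLin_graph_span δ _ _ (h1 _) (h2 _)]
    have : IsIso (prod.fst : P ⨯ (⊤_ A) ⟶ P) := ⟨_, h1 _, h2 _⟩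
    refine spanClass_congr δ (prod.fst : P ⨯ (⊤_ A) ⟶ P) ?_ (by simp)
    ext
    simp [prod.lift_fst]

theorem braiding_naturality {X Y X' Y' : T0 δ} [HasBinaryProduct X.obj X'.obj]
    [HasBinaryProduct Y.obj Y'.obj] [HasBinaryProduct X'.obj X.obj] [HasBinaryProduct Y'.obj Y.obj]
    (f : X ⟶ Y) (f' : X' ⟶ Y') :
    tens X Y X' Y' f f' ≫ graph (Y := T0.of (Y'.obj ⨯ Y.obj)) (prod.lift prod.snd prod.fst) =
      graph (X := T0.of (X.obj ⨯ X'.obj)) (Y := T0.of (X'.obj ⨯ X.obj))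
        (prod.lift prod.snd prod.fst) ≫ tens X' Y' X Y f' f := by
  induction f using T0.induction with
  | zero => simp
  | add f₁ f₂ h₁ h₂ =>
    simp only [Preadditive.add_comp, Preadditive.comp_add, map_add, LinearMap.add_apply, h₁, h₂]
  | smul k f h =>
    simp only [map_smul, LinearMap.smul_apply, Linear.smul_comp, Linear.comp_smul, h]
  | span a b =>
    induction f' using T0.induction with
    | zero => simp
    | add f₁ f₂ h₁ h₂ =>
      simp only [Preadditive.add_comp, Preadditive.comp_add, map_add, LinearMap.add_apply, h₁, h₂]
    | smul k f h =>
      simp only [map_smul, LinearMap.smul_apply, Linear.smul_comp, Linear.comp_smul, h]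
    | span a' b' =>
      rename_i P P'
      change compLin δ _ _ _ (tensLin δ _ _ _ _ (spanClass δ a b) (spanClass δ a' b'))
        (spanClass δ _ _) = compLin δ _ _ _ (spanClass δ _ _)
        (tensLin δ _ _ _ _ (spanClass δ a' b') (spanClass δ a b))
      have hsw : ∀ (x y : A) [HasBinaryProduct x y] [HasBinaryProduct y x],
          (prod.lift prod.snd prod.fst : x ⨯ y ⟶ y ⨯ x) ≫ prod.lift prod.snd prod.fst = 𝟙 _ := by
        intro x y _ _
        ext <;> simp [prod.lift_fst, prod.lift_snd]
      by_cases h : HasBinaryProduct P P'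
      · have := hasBinaryProduct_of_maps (prod.snd : P ⨯ P' ⟶ P') prod.fst
        rw [tensLin_span, tensLin_span, compLin_span_graph,
          compLin_graph_span δ _ _ (hsw _ _) (hsw _ _)]
        have : IsIso (prod.lift prod.snd prod.fst : P ⨯ P' ⟶ P' ⨯ P) := ⟨_, hsw _ _, hsw _ _⟩
        refine spanClass_congr δ (prod.lift prod.snd prod.fst : P ⨯ P' ⟶ P' ⨯ P) ?_ ?_ <;> ext <;>
          simp [prod.lift_fst, prod.lift_snd, prod.lift_fst_assoc, prod.lift_snd_assoc]
      · rw [tensLin_span_of_forall, tensLin_span_of_forall, map_zero, map_zero,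
          LinearMap.zero_apply]
        · intro w f g
          exact h (hasBinaryProduct_of_maps g f)
        · intro w f g
          exact h (hasBinaryProduct_of_maps f g)

end T0

namespace T0Mat

open T0 MonoidalCategory

variable {A : Type u} [Category.{v} A] [KnopRegular A] {K : Type w} [CommRing K]
  {δ : DegreeFunction A K}

/-- The matrix with entries the graphs of `f i : X i ⟶ Y (φ i)`, and zeros elsewhere. -/
noncomputable def gmat {X Y : Mat_ (T0 δ)} (φ : X.ι → Y.ι)
    (f : ∀ i, (X.X i).obj ⟶ (Y.X (φ i)).obj) : X ⟶ Y :=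
  fun i j => graph (f i) ≫ (𝟙 Y : Mat_.Hom Y Y) (φ i) j

theorem gmat_comp_apply {X Y Z : Mat_ (T0 δ)} (φ : X.ι → Y.ι)
    (f : ∀ i, (X.X i).obj ⟶ (Y.X (φ i)).obj) (N : Y ⟶ Z) (i : X.ι) (k : Z.ι) :
    (gmat φ f ≫ N) i k = graph (f i) ≫ N (φ i) k := by
  have h : (𝟙 Y ≫ N) (φ i) k = N (φ i) k := by rw [Category.id_comp]
  rw [Mat_.comp_apply] at h ⊢
  simp only [gmat, Category.assoc]
  rw [← Preadditive.comp_sum, h]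

theorem gmat_apply_self {X Y : Mat_ (T0 δ)} (φ : X.ι → Y.ι)
    (f : ∀ i, (X.X i).obj ⟶ (Y.X (φ i)).obj) (i : X.ι) : gmat φ f i (φ i) = graph (f i) := by
  simp [gmat]

theorem gmat_apply_of_heq {X Y : Mat_ (T0 δ)} (φ : X.ι → Y.ι)
    (f : ∀ i, (X.X i).obj ⟶ (Y.X (φ i)).obj) {i : X.ι} {j : Y.ι} (h : φ i = j)
    (g : (X.X i).obj ⟶ (Y.X j).obj) (hg : HEq (f i) g) : gmat φ f i j = graph g := by
  subst h
  rw [gmat_apply_self, eq_of_heq hg]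

theorem gmat_apply_ne {X Y : Mat_ (T0 δ)} (φ : X.ι → Y.ι)
    (f : ∀ i, (X.X i).obj ⟶ (Y.X (φ i)).obj) {i : X.ι} {j : Y.ι} (h : φ i ≠ j) :
    gmat φ f i j = 0 := by
  simp [gmat, h]

theorem comp_gmat_apply {X Y Z : Mat_ (T0 δ)} (φ : Y.ι → Z.ι) (hφ : Function.Injective φ)
    (f : ∀ i, (Y.X i).obj ⟶ (Z.X (φ i)).obj) (M : X ⟶ Y) (i : X.ι) (j : Y.ι) :
    (M ≫ gmat φ f) i (φ j) = M i j ≫ graph (f j) := by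
  rw [Mat_.comp_apply, Finset.sum_eq_single j, gmat_apply_self]
  · intro b _ hb
    rw [gmat_apply_ne φ f (fun h => hb (hφ h)), comp_zero]
  · simp

theorem gmat_id (X : Mat_ (T0 δ)) : gmat id (fun i => 𝟙 (X.X i).obj) = 𝟙 X := by
  ext i j
  simp only [gmat, graph_id, Category.id_comp, id]

theorem gmat_comp {X Y Z : Mat_ (T0 δ)} (φ : X.ι → Y.ι) (f : ∀ i, (X.X i).obj ⟶ (Y.X (φ i)).obj)
    (ψ : Y.ι → Z.ι) (g : ∀ i, (Y.X i).obj ⟶ (Z.X (ψ i)).obj) :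
    gmat φ f ≫ gmat ψ g = gmat (fun i => ψ (φ i)) (fun i => f i ≫ g (φ i)) := by
  ext i k
  rw [gmat_comp_apply, gmat, gmat, ← Category.assoc, graph_comp]

/-- The isomorphism of matrix objects given by a reindexing and isomorphisms in `A`. -/
noncomputable def gmatIso {X Y : Mat_ (T0 δ)} (φ : X.ι → Y.ι) (ψ : Y.ι → X.ι)
    (f : ∀ i, (X.X i).obj ⟶ (Y.X (φ i)).obj) (g : ∀ j, (Y.X j).obj ⟶ (X.X (ψ j)).obj)
    (h : gmat (fun i => ψ (φ i)) (fun i => f i ≫ g (φ i)) = 𝟙 X)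
    (h' : gmat (fun j => φ (ψ j)) (fun j => g j ≫ f (ψ j)) = 𝟙 Y) : X ≅ Y where
  hom := gmat φ f
  inv := gmat ψ g
  hom_inv_id := by rw [gmat_comp, h]
  inv_hom_id := by rw [gmat_comp, h']

open Classical in
/-- The tensor product of two families of objects: the family of those products `X i ⨯ Y j` that
exist. -/
noncomputable abbrev tensorObj (X Y : Mat_ (T0 δ)) : Mat_ (T0 δ) where
  ι := {p : X.ι × Y.ι // HasBinaryProduct (X.X p.1).obj (Y.X p.2).obj}
  fintype := inferInstance
  X p := haveI := p.2; T0.of ((X.X p.1.1).obj ⨯ (Y.X p.1.2).obj)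

/-- The tensor product (Kronecker product) of two matrices. -/
noncomputable def tensorHom {X Y X' Y' : Mat_ (T0 δ)} (f : X ⟶ Y) (g : X' ⟶ Y') :
    tensorObj X X' ⟶ tensorObj Y Y' := fun p q =>
  haveI := p.2
  haveI := q.2
  tens (X.X p.1.1) (Y.X q.1.1) (X'.X p.1.2) (Y'.X q.1.2) (f p.1.1 q.1.1) (g p.1.2 q.1.2)

theorem tensorHom_comp {X Y Z X' Y' Z' : Mat_ (T0 δ)} (f : X ⟶ Y) (g : Y ⟶ Z) (f' : X' ⟶ Y')
    (g' : Y' ⟶ Z') :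
    tensorHom f f' ≫ tensorHom g g' = tensorHom (f ≫ g) (f' ≫ g') := by
  classical
  ext p r
  have hp := p.2
  have hr := r.2
  rw [Mat_.comp_apply]
  simp only [tensorHom, Mat_.comp_apply, map_sum, LinearMap.sum_apply]
  rw [Finset.sum_comm, ← Fintype.sum_prod_type', ← Fintype.sum_subtype_add_sum_subtype
    (fun q : Y.ι × Y'.ι => HasBinaryProduct (Y.X q.1).obj (Y'.X q.2).obj)]
  rw [Finset.sum_eq_zero (s := (Finset.univ : Finset {q : Y.ι × Y'.ι // ¬ _})), add_zero]
  · refine Fintype.sum_equiv (Equiv.refl _) _ _ ?_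
    intro q
    have := q.2
    exact (tens_comp (f p.1.1 q.1.1) (g q.1.1 r.1.1) (f' p.1.2 q.1.2) (g' q.1.2 r.1.2)).symm
  · intro q _
    exact tens_comp_eq_zero q.2 _ _ _ _

theorem hasProd_of_maps {x y x' y' : A} (h : HasBinaryProduct x x') (f : x ⟶ y) (g : x' ⟶ y') :
    HasBinaryProduct y y' :=
  hasBinaryProduct_of_maps ((prod.fst : x ⨯ x' ⟶ x) ≫ f) (prod.snd ≫ g)

theorem tensorHom_gmat {X Y X' Y' : Mat_ (T0 δ)} (φ : X.ι → Y.ι)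
    (f : ∀ i, (X.X i).obj ⟶ (Y.X (φ i)).obj) (φ' : X'.ι → Y'.ι)
    (f' : ∀ i, (X'.X i).obj ⟶ (Y'.X (φ' i)).obj) :
    tensorHom (gmat φ f) (gmat φ' f') =
      gmat (X := tensorObj X X') (Y := tensorObj Y Y')
        (fun p => ⟨(φ p.1.1, φ' p.1.2), hasProd_of_maps p.2 (f _) (f' _)⟩)
        (fun p => haveI := p.2; haveI := hasProd_of_maps p.2 (f p.1.1) (f' p.1.2);
          prod.map (f p.1.1) (f' p.1.2)) := by
  ext p q
  have := p.2
  have := q.2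
  by_cases h1 : φ p.1.1 = q.1.1
  · by_cases h2 : φ' p.1.2 = q.1.2
    · obtain ⟨⟨q1, q2⟩, hq⟩ := q
      dsimp only at h1 h2
      subst h1 h2
      refine Eq.trans ?_ (gmat_apply_of_heq (X := tensorObj X X') (Y := tensorObj Y Y') _ _
        (i := p) (j := ⟨(φ p.1.1, φ' p.1.2), hq⟩) ?_ (prod.map (f p.1.1) (f' p.1.2)) ?_).symm
      · simp only [tensorHom, gmat_apply_self]
        exact tens_graph _ _
      · rfl
      · rfl
    · refine Eq.trans ?_ (gmat_apply_ne (X := tensorObj X X') (Y := tensorObj Y Y') _ _ ?_).symm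
      · simp only [tensorHom, gmat_apply_ne _ f' h2, map_zero]
      · intro h
        exact h2 (congrArg (fun z => z.1.2) h)
  · refine Eq.trans ?_ (gmat_apply_ne (X := tensorObj X X') (Y := tensorObj Y Y') _ _ ?_).symm
    · simp only [tensorHom, gmat_apply_ne _ f h1, map_zero, LinearMap.zero_apply]
    · intro h
      exact h1 (congrArg (fun z => z.1.1) h)

/-- The unit object: the terminal object of `A`. -/
noncomputable abbrev unit (δ : DegreeFunction A K) : Mat_ (T0 δ) where
  ι := Unit
  X _ := T0.of (⊤_ A)

theorem gmat_congr {X Y : Mat_ (T0 δ)} {φ ψ : X.ι → Y.ι} {f : ∀ i, (X.X i).obj ⟶ (Y.X (φ i)).obj}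
    {g : ∀ i, (X.X i).obj ⟶ (Y.X (ψ i)).obj} (h : ∀ i, φ i = ψ i) (hf : ∀ i, HEq (f i) (g i)) :
    gmat φ f = gmat ψ g := by
  obtain rfl : φ = ψ := funext h
  obtain rfl : f = g := funext fun i => eq_of_heq (hf i)
  rfl

theorem gmat_eq_id {X : Mat_ (T0 δ)} {φ : X.ι → X.ι} {f : ∀ i, (X.X i).obj ⟶ (X.X (φ i)).obj}
    (h : ∀ i, φ i = i) (hf : ∀ i, HEq (f i) (𝟙 (X.X i).obj)) : gmat φ f = 𝟙 X := by
  rw [← gmat_id]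
  exact gmat_congr h hf

theorem hasProd_right {x y z : A} (h : HasBinaryProduct x y) (_ : HasBinaryProduct (x ⨯ y) z) :
    HasBinaryProduct y z :=
  hasBinaryProduct_of_maps ((prod.fst : (x ⨯ y) ⨯ z ⟶ x ⨯ y) ≫ prod.snd) prod.snd

theorem hasProd_assoc {x y z : A} (h : HasBinaryProduct x y) (_ : HasBinaryProduct (x ⨯ y) z)
    (h' : HasBinaryProduct y z) : HasBinaryProduct x (y ⨯ z) :=
  hasBinaryProduct_of_maps ((prod.fst : (x ⨯ y) ⨯ z ⟶ x ⨯ y) ≫ prod.fst)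
    (prod.lift (prod.fst ≫ prod.snd) prod.snd)

theorem hasProd_left {x y z : A} (h : HasBinaryProduct y z) (_ : HasBinaryProduct x (y ⨯ z)) :
    HasBinaryProduct x y :=
  hasBinaryProduct_of_maps (prod.fst : x ⨯ (y ⨯ z) ⟶ x) (prod.snd ≫ prod.fst)

theorem hasProd_assoc' {x y z : A} (h : HasBinaryProduct y z) (_ : HasBinaryProduct x (y ⨯ z))
    (h' : HasBinaryProduct x y) : HasBinaryProduct (x ⨯ y) z :=
  hasBinaryProduct_of_maps (w := x ⨯ (y ⨯ z)) (prod.lift prod.fst (prod.snd ≫ prod.fst))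
    (prod.snd ≫ prod.snd)

theorem hasProd_symm {x y : A} (_ : HasBinaryProduct x y) : HasBinaryProduct y x :=
  hasBinaryProduct_of_maps (prod.snd : x ⨯ y ⟶ y) prod.fst

theorem hasProd_terminal_left (x : A) : HasBinaryProduct (⊤_ A) x :=
  hasBinaryProduct_of_maps (terminal.from x) (𝟙 x)

theorem hasProd_terminal_right (x : A) : HasBinaryProduct x (⊤_ A) :=
  hasBinaryProduct_of_maps (𝟙 x) (terminal.from x)

/-- The reindexing underlying the associator. -/
def assocIdx {X Y Z : Mat_ (T0 δ)} (p : (tensorObj (tensorObj X Y) Z).ι) :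
    (tensorObj X (tensorObj Y Z)).ι :=
  ⟨(p.1.1.1.1, ⟨(p.1.1.1.2, p.1.2), hasProd_right p.1.1.2 p.2⟩),
    hasProd_assoc p.1.1.2 p.2 (hasProd_right p.1.1.2 p.2)⟩

/-- The inverse of the reindexing underlying the associator. -/
def assocIdxInv {X Y Z : Mat_ (T0 δ)} (p : (tensorObj X (tensorObj Y Z)).ι) :
    (tensorObj (tensorObj X Y) Z).ι :=
  ⟨(⟨(p.1.1, p.1.2.1.1), hasProd_left p.1.2.2 p.2⟩, p.1.2.1.2),
    hasProd_assoc' p.1.2.2 p.2 (hasProd_left p.1.2.2 p.2)⟩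

/-- The components of the associator. -/
noncomputable def assocComp {X Y Z : Mat_ (T0 δ)} (p : (tensorObj (tensorObj X Y) Z).ι) :
    ((tensorObj (tensorObj X Y) Z).X p).obj ⟶ ((tensorObj X (tensorObj Y Z)).X (assocIdx p)).obj :=
  haveI := p.1.1.2
  haveI := p.2
  haveI : HasBinaryProduct (Y.X p.1.1.1.2).obj (Z.X p.1.2).obj := hasProd_right p.1.1.2 p.2
  haveI : HasBinaryProduct (X.X p.1.1.1.1).obj ((Y.X p.1.1.1.2).obj ⨯ (Z.X p.1.2).obj) :=
    hasProd_assoc p.1.1.2 p.2 (hasProd_right p.1.1.2 p.2)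
  assocHom (X.X p.1.1.1.1).obj (Y.X p.1.1.1.2).obj (Z.X p.1.2).obj

/-- The components of the inverse associator. -/
noncomputable def assocCompInv {X Y Z : Mat_ (T0 δ)} (p : (tensorObj X (tensorObj Y Z)).ι) :
    ((tensorObj X (tensorObj Y Z)).X p).obj ⟶
      ((tensorObj (tensorObj X Y) Z).X (assocIdxInv p)).obj :=
  haveI := p.1.2.2
  haveI := p.2
  haveI : HasBinaryProduct (X.X p.1.1).obj (Y.X p.1.2.1.1).obj := hasProd_left p.1.2.2 p.2
  haveI : HasBinaryProduct ((X.X p.1.1).obj ⨯ (Y.X p.1.2.1.1).obj) (Z.X p.1.2.1.2).obj :=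
    hasProd_assoc' p.1.2.2 p.2 (hasProd_left p.1.2.2 p.2)
  assocInv (X.X p.1.1).obj (Y.X p.1.2.1.1).obj (Z.X p.1.2.1.2).obj

noncomputable instance : MonoidalCategoryStruct (Mat_ (T0 δ)) where
  tensorObj := tensorObj
  tensorHom := tensorHom
  whiskerLeft X _ _ f := tensorHom (𝟙 X) f
  whiskerRight f Y := tensorHom f (𝟙 Y)
  tensorUnit := unit δ
  associator X Y Z := gmatIso assocIdx assocIdxInv assocComp assocCompInv
    (gmat_eq_id (fun _ => rfl) fun p =>
      haveI := p.1.1.2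
      haveI := p.2
      haveI : HasBinaryProduct (Y.X p.1.1.1.2).obj (Z.X p.1.2).obj := hasProd_right p.1.1.2 p.2
      haveI : HasBinaryProduct (X.X p.1.1.1.1).obj ((Y.X p.1.1.1.2).obj ⨯ (Z.X p.1.2).obj) :=
        hasProd_assoc p.1.1.2 p.2 (hasProd_right p.1.1.2 p.2)
      heq_of_eq (assocHom_inv (X.X p.1.1.1.1).obj (Y.X p.1.1.1.2).obj (Z.X p.1.2).obj))
    (gmat_eq_id (fun _ => rfl) fun p =>
      haveI := p.1.2.2
      haveI := p.2
      haveI : HasBinaryProduct (X.X p.1.1).obj (Y.X p.1.2.1.1).obj := hasProd_left p.1.2.2 p.2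
      haveI : HasBinaryProduct ((X.X p.1.1).obj ⨯ (Y.X p.1.2.1.1).obj) (Z.X p.1.2.1.2).obj :=
        hasProd_assoc' p.1.2.2 p.2 (hasProd_left p.1.2.2 p.2)
      heq_of_eq (assocInv_hom (X.X p.1.1).obj (Y.X p.1.2.1.1).obj (Z.X p.1.2.1.2).obj))
  leftUnitor X := gmatIso (X := tensorObj (unit δ) X) (Y := X) (fun p => p.1.2)
    (fun i => ⟨((), i), hasProd_terminal_left _⟩)
    (fun p => haveI := p.2; prod.snd)
    (fun i => haveI := hasProd_terminal_left (X.X i).obj; prod.lift (terminal.from _) (𝟙 _))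
    (gmat_eq_id (fun _ => rfl) fun p => by
      have := p.2
      refine heq_of_eq (prod.hom_ext (terminal.hom_ext _ _) ?_)
      simp [prod.lift_snd])
    (gmat_eq_id (fun _ => rfl) fun i => by
      have := hasProd_terminal_left (X.X i).obj
      exact heq_of_eq (prod.lift_snd _ _))
  rightUnitor X := gmatIso (X := tensorObj X (unit δ)) (Y := X) (fun p => p.1.1)
    (fun i => ⟨(i, ()), hasProd_terminal_right _⟩)
    (fun p => haveI := p.2; prod.fst)
    (fun i => haveI := hasProd_terminal_right (X.X i).obj; prod.lift (𝟙 _) (terminal.from _))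
    (gmat_eq_id (fun _ => rfl) fun p => by
      have := p.2
      refine heq_of_eq (prod.hom_ext ?_ (terminal.hom_ext _ _))
      simp [prod.lift_fst])
    (gmat_eq_id (fun _ => rfl) fun i => by
      have := hasProd_terminal_right (X.X i).obj
      exact heq_of_eq (prod.lift_fst _ _))

theorem tensorHom_id_id (X Y : Mat_ (T0 δ)) : tensorHom (𝟙 X) (𝟙 Y) = 𝟙 (tensorObj X Y) := by
  rw [← gmat_id, ← gmat_id, tensorHom_gmat]
  refine gmat_eq_id (fun _ => rfl) fun p => ?_
  have := p.2
  exact heq_of_eq prod.map_id_id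

theorem associator_nat {X₁ X₂ X₃ Y₁ Y₂ Y₃ : Mat_ (T0 δ)} (f₁ : X₁ ⟶ Y₁) (f₂ : X₂ ⟶ Y₂)
    (f₃ : X₃ ⟶ Y₃) :
    tensorHom (tensorHom f₁ f₂) f₃ ≫ gmat assocIdx assocComp =
      gmat assocIdx assocComp ≫ tensorHom f₁ (tensorHom f₂ f₃) := by
  ext p q
  obtain ⟨q, rfl⟩ : ∃ q', assocIdx q' = q := ⟨assocIdxInv q, rfl⟩
  refine (comp_gmat_apply _ (Function.LeftInverse.injective (g := assocIdxInv) fun _ => rfl)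
    _ _ p q).trans (Eq.trans ?_ (gmat_comp_apply _ _ _ p (assocIdx q)).symm)
  have := p.1.1.2
  have := p.2
  have : HasBinaryProduct (X₂.X p.1.1.1.2).obj (X₃.X p.1.2).obj := hasProd_right p.1.1.2 p.2
  have : HasBinaryProduct (X₁.X p.1.1.1.1).obj ((X₂.X p.1.1.1.2).obj ⨯ (X₃.X p.1.2).obj) :=
    hasProd_assoc p.1.1.2 p.2 (hasProd_right p.1.1.2 p.2)
  have := q.1.1.2
  have := q.2
  have : HasBinaryProduct (Y₂.X q.1.1.1.2).obj (Y₃.X q.1.2).obj := hasProd_right q.1.1.2 q.2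
  have : HasBinaryProduct (Y₁.X q.1.1.1.1).obj ((Y₂.X q.1.1.1.2).obj ⨯ (Y₃.X q.1.2).obj) :=
    hasProd_assoc q.1.1.2 q.2 (hasProd_right q.1.1.2 q.2)
  exact assoc_naturality (f₁ p.1.1.1.1 q.1.1.1.1) (f₂ p.1.1.1.2 q.1.1.1.2) (f₃ p.1.2 q.1.2)

/-- The pentagon identity for products. -/
theorem prod_pentagon (w x y z : A) [HasBinaryProduct w x] [HasBinaryProduct (w ⨯ x) y]
    [HasBinaryProduct ((w ⨯ x) ⨯ y) z] [HasBinaryProduct x y] [HasBinaryProduct w (x ⨯ y)]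
    [HasBinaryProduct (w ⨯ (x ⨯ y)) z] [HasBinaryProduct (x ⨯ y) z]
    [HasBinaryProduct w ((x ⨯ y) ⨯ z)] [HasBinaryProduct y z] [HasBinaryProduct x (y ⨯ z)]
    [HasBinaryProduct w (x ⨯ (y ⨯ z))] [HasBinaryProduct (w ⨯ x) (y ⨯ z)] :
    prod.map (assocHom w x y) (𝟙 z) ≫ assocHom w (x ⨯ y) z ≫ prod.map (𝟙 w) (assocHom x y z) =
      assocHom (w ⨯ x) y z ≫ assocHom w x (y ⨯ z) := by
  unfold assocHom
  ext <;> simp [prod.lift_fst, prod.lift_snd, prod.lift_fst_assoc, prod.lift_snd_assoc]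

/-- The triangle identity for products. -/
theorem prod_triangle (x u y : A) [HasBinaryProduct x u] [HasBinaryProduct (x ⨯ u) y]
    [HasBinaryProduct u y] [HasBinaryProduct x (u ⨯ y)] [HasBinaryProduct x y] :
    assocHom x u y ≫ prod.map (𝟙 x) prod.snd = prod.map prod.fst (𝟙 y) := by
  unfold assocHom
  ext <;> simp [prod.lift_fst, prod.lift_snd, prod.lift_fst_assoc, prod.lift_snd_assoc]

noncomputable instance : MonoidalCategory (Mat_ (T0 δ)) :=
  MonoidalCategory.ofTensorHom
    (id_tensorHom_id := tensorHom_id_id)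
    (id_tensorHom := fun _ _ _ _ => rfl)
    (tensorHom_id := fun _ _ => rfl)
    (tensorHom_comp_tensorHom := fun f₁ f₂ g₁ g₂ => tensorHom_comp f₁ g₁ f₂ g₂)
    (associator_naturality := associator_nat)
    (leftUnitor_naturality := by
      intro X Y f
      ext p j
      obtain ⟨q, rfl⟩ : ∃ q : (tensorObj (unit δ) Y).ι, q.1.2 = j :=
        ⟨⟨((), j), hasProd_terminal_left _⟩, rfl⟩
      refine (comp_gmat_apply (Y := tensorObj (unit δ) Y) _ ?_
        _ _ p q).trans (Eq.trans ?_ (gmat_comp_apply (X := tensorObj (unit δ) X) _ _ _ p _).symm)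
      · rintro ⟨⟨⟨⟩, a⟩, ha⟩ ⟨⟨⟨⟩, b⟩, hb⟩ (h : a = b)
        subst h
        rfl
      · have := p.2
        have := q.2
        refine Eq.trans ?_ (leftUnitor_naturality (f p.1.2 q.1.2))
        exact congrArg (fun z => tens (T0.of (⊤_ A)) (T0.of (⊤_ A)) (X.X p.1.2) (Y.X q.1.2) z
          (f p.1.2 q.1.2) ≫ graph (Y := Y.X q.1.2) prod.snd) (Mat_.id_apply_self (unit δ) ()))
    (rightUnitor_naturality := by
      intro X Y f
      ext p j
      obtain ⟨q, rfl⟩ : ∃ q : (tensorObj Y (unit δ)).ι, q.1.1 = j :=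
        ⟨⟨(j, ()), hasProd_terminal_right _⟩, rfl⟩
      refine (comp_gmat_apply (Y := tensorObj Y (unit δ)) _ ?_
        _ _ p q).trans (Eq.trans ?_ (gmat_comp_apply (X := tensorObj X (unit δ)) _ _ _ p _).symm)
      · rintro ⟨⟨a, ⟨⟩⟩, ha⟩ ⟨⟨b, ⟨⟩⟩, hb⟩ (h : a = b)
        subst h
        rfl
      · have := p.2
        have := q.2
        refine Eq.trans ?_ (rightUnitor_naturality (f p.1.1 q.1.1))
        exact congrArg (fun z => tens (X.X p.1.1) (Y.X q.1.1) (T0.of (⊤_ A)) (T0.of (⊤_ A))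
          (f p.1.1 q.1.1) z ≫ graph (Y := Y.X q.1.1) prod.fst) (Mat_.id_apply_self (unit δ) ()))
    (pentagon := by
      intro W X Y Z
      change tensorHom (gmat assocIdx assocComp) (𝟙 Z) ≫ gmat assocIdx assocComp ≫
        tensorHom (𝟙 W) (gmat assocIdx assocComp) =
          gmat assocIdx assocComp ≫ gmat assocIdx assocComp
      rw [← gmat_id, ← gmat_id, tensorHom_gmat, tensorHom_gmat, gmat_comp, gmat_comp, gmat_comp]
      refine gmat_congr (fun _ => rfl) fun p => heq_of_eq ?_
      have h1 := p.1.1.1.1.2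
      have h2 := p.1.1.2
      have h3 := p.2
      have h4 := hasProd_right h1 h2
      have h5 := hasProd_assoc h1 h2 h4
      have h6 := hasProd_right h2 h3
      have h7 := hasProd_assoc h2 h3 h6
      have h8 := hasProd_right h1 h7
      have h9 := hasProd_assoc h1 h7 h8
      have h10 := hasProd_assoc' h6 h8 h4
      have h11 : HasBinaryProduct (W.X p.1.1.1.1.1.1).obj
          (((X.X p.1.1.1.1.1.2).obj ⨯ (Y.X p.1.1.1.2).obj) ⨯ (Z.X p.1.2).obj) :=
        hasProd_of_maps h9 (𝟙 _) (assocInv _ _ _)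
      have h12 : HasBinaryProduct ((W.X p.1.1.1.1.1.1).obj ⨯ ((X.X p.1.1.1.1.1.2).obj ⨯
          (Y.X p.1.1.1.2).obj)) (Z.X p.1.2).obj := hasProd_assoc' h10 h11 h5
      exact prod_pentagon (W.X p.1.1.1.1.1.1).obj (X.X p.1.1.1.1.1.2).obj (Y.X p.1.1.1.2).obj
        (Z.X p.1.2).obj)
    (triangle := by
      intro X Y
      change gmat assocIdx assocComp ≫ tensorHom (𝟙 X) (gmat (X := tensorObj (unit δ) Y) (Y := Y)
        (fun p => p.1.2) (fun p => haveI := p.2; prod.snd)) =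
        tensorHom (gmat (X := tensorObj X (unit δ)) (Y := X) (fun p => p.1.1)
          (fun p => haveI := p.2; prod.fst)) (𝟙 Y)
      rw [← gmat_id, ← gmat_id, tensorHom_gmat, tensorHom_gmat, gmat_comp]
      refine gmat_congr (fun _ => rfl) fun p => heq_of_eq ?_
      have h1 := p.1.1.2
      have h2 := p.2
      have h3 := hasProd_right h1 h2
      have h4 := hasProd_assoc h1 h2 h3
      have h5 := hasProd_of_maps h4 (𝟙 _) prod.snd
      exact prod_triangle (X.X p.1.1.1.1).obj (⊤_ A) (Y.X p.1.2).obj)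

/-- The symmetry of the tensor product. -/
noncomputable def swap (X Y : Mat_ (T0 δ)) : tensorObj X Y ⟶ tensorObj Y X :=
  gmat (fun p => ⟨(p.1.2, p.1.1), hasProd_symm p.2⟩)
    (fun p => haveI := p.2; haveI := hasProd_symm p.2; prod.lift prod.snd prod.fst)

theorem swap_nat {X Y X' Y' : Mat_ (T0 δ)} (f : X ⟶ Y) (g : X' ⟶ Y') :
    tensorHom f g ≫ swap Y Y' = swap X X' ≫ tensorHom g f := by
  ext p q
  obtain ⟨q, rfl⟩ : ∃ q' : (tensorObj Y Y').ι,
      (⟨(q'.1.2, q'.1.1), hasProd_symm q'.2⟩ : (tensorObj Y' Y).ι) = q :=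
    ⟨⟨(q.1.2, q.1.1), hasProd_symm q.2⟩, rfl⟩
  refine (comp_gmat_apply _ (Function.LeftInverse.injective
    (g := fun q => ⟨(q.1.2, q.1.1), hasProd_symm q.2⟩) fun _ => rfl) _ _ p q).trans
    (Eq.trans ?_ (gmat_comp_apply _ _ _ p _).symm)
  have := p.2
  have := hasProd_symm p.2
  have := q.2
  have := hasProd_symm q.2
  exact braiding_naturality (f p.1.1 q.1.1) (g p.1.2 q.1.2)

theorem swap_swap (X Y : Mat_ (T0 δ)) : swap X Y ≫ swap Y X = 𝟙 (tensorObj X Y) := by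
  rw [swap, swap, gmat_comp]
  refine gmat_eq_id (fun _ => rfl) fun p => ?_
  have := p.2
  have := hasProd_symm p.2
  refine heq_of_eq ?_
  ext <;> simp [prod.lift_fst, prod.lift_snd]

theorem prod_hexagon (x y z : A) [HasBinaryProduct x y] [HasBinaryProduct (x ⨯ y) z]
    [HasBinaryProduct y z] [HasBinaryProduct x (y ⨯ z)] [HasBinaryProduct (y ⨯ z) x]
    [HasBinaryProduct z x] [HasBinaryProduct y (z ⨯ x)] [HasBinaryProduct y x]
    [HasBinaryProduct (y ⨯ x) z] [HasBinaryProduct x z] [HasBinaryProduct y (x ⨯ z)] :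
    assocHom x y z ≫ (prod.lift prod.snd prod.fst : x ⨯ (y ⨯ z) ⟶ (y ⨯ z) ⨯ x) ≫ assocHom y z x =
      prod.map (prod.lift prod.snd prod.fst : x ⨯ y ⟶ y ⨯ x) (𝟙 z) ≫ assocHom y x z ≫
        prod.map (𝟙 y) (prod.lift prod.snd prod.fst : x ⨯ z ⟶ z ⨯ x) := by
  unfold assocHom
  ext <;> simp [prod.lift_fst, prod.lift_snd, prod.lift_fst_assoc, prod.lift_snd_assoc]

theorem prod_hexagon_reverse (x y z : A) [HasBinaryProduct x y] [HasBinaryProduct (x ⨯ y) z]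
    [HasBinaryProduct y z] [HasBinaryProduct x (y ⨯ z)] [HasBinaryProduct z (x ⨯ y)]
    [HasBinaryProduct z x] [HasBinaryProduct (z ⨯ x) y] [HasBinaryProduct z y]
    [HasBinaryProduct x (z ⨯ y)] [HasBinaryProduct x z] [HasBinaryProduct (x ⨯ z) y] :
    assocInv x y z ≫ (prod.lift prod.snd prod.fst : (x ⨯ y) ⨯ z ⟶ z ⨯ (x ⨯ y)) ≫ assocInv z x y =
      prod.map (𝟙 x) (prod.lift prod.snd prod.fst : y ⨯ z ⟶ z ⨯ y) ≫ assocInv x z y ≫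
        prod.map (prod.lift prod.snd prod.fst : x ⨯ z ⟶ z ⨯ x) (𝟙 y) := by
  unfold assocInv
  ext <;> simp [prod.lift_fst, prod.lift_snd, prod.lift_fst_assoc, prod.lift_snd_assoc]

noncomputable instance : BraidedCategory (Mat_ (T0 δ)) where
  braiding X Y := ⟨swap X Y, swap Y X, swap_swap X Y, swap_swap Y X⟩
  braiding_naturality_right X _ _ f := swap_nat (𝟙 X) f
  braiding_naturality_left f Z := swap_nat f (𝟙 Z)
  hexagon_forward := by
    intro X Y Z
    change gmat assocIdx assocComp ≫ swap X (tensorObj Y Z) ≫ gmat assocIdx assocComp =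
      tensorHom (swap X Y) (𝟙 Z) ≫ gmat assocIdx assocComp ≫ tensorHom (𝟙 Y) (swap X Z)
    rw [← gmat_id, ← gmat_id, swap, swap, swap, tensorHom_gmat, tensorHom_gmat, gmat_comp,
      gmat_comp, gmat_comp, gmat_comp]
    refine gmat_congr (fun _ => rfl) fun p => heq_of_eq ?_
    have h1 := p.1.1.2
    have h2 := p.2
    have h3 := hasProd_right h1 h2
    have h4 := hasProd_assoc h1 h2 h3
    have h5 := hasProd_symm h4
    have h6 := hasProd_right h3 h5
    have h7 := hasProd_assoc h3 h5 h6
    have h8 := hasProd_symm h1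
    have h9 := hasProd_of_maps h2 (prod.lift prod.snd prod.fst) (𝟙 _)
    have h10 := hasProd_symm h6
    have h11 := hasProd_assoc h8 h9 h10
    exact prod_hexagon (X.X p.1.1.1.1).obj (Y.X p.1.1.1.2).obj (Z.X p.1.2).obj
  hexagon_reverse := by
    intro X Y Z
    change gmat assocIdxInv assocCompInv ≫ swap (tensorObj X Y) Z ≫ gmat assocIdxInv assocCompInv =
      tensorHom (𝟙 X) (swap Y Z) ≫ gmat assocIdxInv assocCompInv ≫ tensorHom (swap X Z) (𝟙 Y)
    rw [← gmat_id, ← gmat_id, swap, swap, swap, tensorHom_gmat, tensorHom_gmat, gmat_comp,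
      gmat_comp, gmat_comp, gmat_comp]
    refine gmat_congr (fun _ => rfl) fun p => heq_of_eq ?_
    have h1 := p.1.2.2
    have h2 := p.2
    have h3 := hasProd_left h1 h2
    have h4 := hasProd_assoc' h1 h2 h3
    have h5 := hasProd_symm h4
    have h6 := hasProd_left h3 h5
    have h7 := hasProd_assoc' h3 h5 h6
    have h8 := hasProd_symm h1
    have h9 := hasProd_of_maps h2 (𝟙 _) (prod.lift prod.snd prod.fst)
    have h10 := hasProd_symm h6
    have h11 := hasProd_assoc' h8 h9 h10
    exact prod_hexagon_reverse (X.X p.1.1).obj (Y.X p.1.2.1.1).obj (Z.X p.1.2.1.2).obj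

noncomputable instance : SymmetricCategory (Mat_ (T0 δ)) where
  symmetry X Y := swap_swap X Y

end T0Mat

section Linear

variable {K : Type w} [CommRing K] {C : Type u} [Category.{v} C] [Preadditive C] [Linear K C]

instance : Linear K (Mat_ C) where
  homModule X Y := inferInstanceAs (Module K (∀ (i : X.ι) (j : Y.ι), X.X i ⟶ Y.X j))
  smul_comp X Y Z r f g := by
    ext i k
    change ((_ : X ⟶ Z) i k) = r • ((f ≫ g : X ⟶ Z) i k)
    rw [Mat_.comp_apply, Mat_.comp_apply, Finset.smul_sum]
    exact Finset.sum_congr rfl fun j _ => Linear.smul_comp _ _ _ _ _ _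
  comp_smul X Y Z f r g := by
    ext i k
    change ((_ : X ⟶ Z) i k) = r • ((f ≫ g : X ⟶ Z) i k)
    rw [Mat_.comp_apply, Mat_.comp_apply, Finset.smul_sum]
    exact Finset.sum_congr rfl fun j _ => Linear.comp_smul _ _ _ _ _ _

instance (P Q : Idempotents.Karoubi C) : SMul K (P ⟶ Q) where
  smul r f := ⟨r • f.f, by rw [Linear.smul_comp, Linear.comp_smul]; exact congrArg _ f.comm⟩

instance : Linear K (Idempotents.Karoubi C) where
  homModule _ _ :=
    { one_smul := fun _ => Idempotents.Karoubi.hom_ext_iff.mpr (one_smul _ _)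
      mul_smul := fun _ _ _ => Idempotents.Karoubi.hom_ext_iff.mpr (mul_smul _ _ _)
      smul_zero := fun _ => Idempotents.Karoubi.hom_ext_iff.mpr (smul_zero _)
      smul_add := fun _ _ _ => Idempotents.Karoubi.hom_ext_iff.mpr (smul_add _ _ _)
      add_smul := fun _ _ _ => Idempotents.Karoubi.hom_ext_iff.mpr (add_smul _ _ _)
      zero_smul := fun _ => Idempotents.Karoubi.hom_ext_iff.mpr (zero_smul _ _) }
  smul_comp _ _ _ _ _ _ := Idempotents.Karoubi.hom_ext_iff.mpr (Linear.smul_comp _ _ _ _ _ _)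
  comp_smul _ _ _ _ _ _ := Idempotents.Karoubi.hom_ext_iff.mpr (Linear.comp_smul _ _ _ _ _ _)

end Linear

section KaroubiMonoidal

open MonoidalCategory Idempotents

section

variable {C : Type u} [Category.{v} C]

/-- The morphism `f : (X, p) ⟶ (Y, q)` is induced by the morphism `i : X ⟶ Y`, which is compatible
with the idempotents. -/
def InducedBy {P Q : Karoubi C} (f : P ⟶ Q) (i : P.X ⟶ Q.X) : Prop :=
  f.f = P.p ≫ i ∧ P.p ≫ i = i ≫ Q.p

theorem InducedBy.id (P : Karoubi C) : InducedBy (𝟙 P) (𝟙 P.X) := ⟨by simp, by simp⟩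

theorem InducedBy.comp {P Q R : Karoubi C} {f : P ⟶ Q} {g : Q ⟶ R} {i : P.X ⟶ Q.X}
    {j : Q.X ⟶ R.X} (hf : InducedBy f i) (hg : InducedBy g j) : InducedBy (f ≫ g) (i ≫ j) := by
  refine ⟨?_, ?_⟩
  · rw [Karoubi.comp_f, hf.1, hg.1, Category.assoc, ← Category.assoc i, ← hf.2]
    simp
  · rw [← Category.assoc, hf.2, Category.assoc, hg.2, Category.assoc]

theorem InducedBy.eq {P Q : Karoubi C} {f g : P ⟶ Q} {i j : P.X ⟶ Q.X} (hf : InducedBy f i)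
    (hg : InducedBy g j) (h : i = j) : f = g := by
  ext
  rw [hf.1, hg.1, h]

/-- The isomorphism `(X, p) ≅ (Y, q)` induced by an isomorphism `X ≅ Y` compatible with the
idempotents. -/
def karoubiIso {P Q : Karoubi C} (i : P.X ≅ Q.X) (h : P.p ≫ i.hom = i.hom ≫ Q.p) : P ≅ Q where
  hom := ⟨P.p ≫ i.hom, by simp only [Category.assoc, ← h]; simp⟩
  inv := ⟨Q.p ≫ i.inv, by
    have : i.inv ≫ P.p = Q.p ≫ i.inv := by rw [Iso.inv_comp_eq, ← Category.assoc, ← h]; simp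
    simp [this]⟩
  hom_inv_id := by
    ext
    simp [← reassoc_of% h]
  inv_hom_id := by
    have : i.inv ≫ P.p = Q.p ≫ i.inv := by rw [Iso.inv_comp_eq, ← Category.assoc, ← h]; simp
    ext
    simp [h]

theorem InducedBy.iso_hom {P Q : Karoubi C} (i : P.X ≅ Q.X) (h : P.p ≫ i.hom = i.hom ≫ Q.p) :
    InducedBy (karoubiIso i h).hom i.hom := ⟨rfl, h⟩

theorem InducedBy.iso_inv {P Q : Karoubi C} (i : P.X ≅ Q.X) (h : P.p ≫ i.hom = i.hom ≫ Q.p) :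
    InducedBy (karoubiIso i h).inv i.inv :=
  ⟨rfl, by rw [Iso.eq_inv_comp, ← Category.assoc, ← h]; simp⟩

/-- Compatibility of an induced isomorphism with morphisms follows from naturality. -/
theorem InducedBy.naturality {P Q P' Q' : Karoubi C} {α : P ⟶ Q} {β : P' ⟶ Q'} {i : P.X ⟶ Q.X}
    {j : P'.X ⟶ Q'.X} (hα : InducedBy α i) (hβ : InducedBy β j)
    (f : P ⟶ P') (g : Q ⟶ Q') (hfg : f.f ≫ j = i ≫ g.f) : f ≫ β = α ≫ g := by
  ext
  rw [Karoubi.comp_f, Karoubi.comp_f, hα.1, hβ.1, ← Category.assoc, Karoubi.comp_p, hfg, hα.2,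
    Category.assoc, Karoubi.p_comp]

end

variable {C : Type u} [Category.{v} C] [MonoidalCategory C]

/-- The tensor product of two objects `(X, p)`, `(Y, q)` is `(X ⊗ Y, p ⊗ q)`. -/
abbrev karoubiTensorObj (P Q : Karoubi C) : Karoubi C where
  X := P.X ⊗ Q.X
  p := P.p ⊗ₘ Q.p
  idem := by rw [tensorHom_comp_tensorHom, P.idem, Q.idem]

/-- The tensor product of two morphisms. -/
def karoubiTensorHom {P Q P' Q' : Karoubi C} (f : P ⟶ Q) (g : P' ⟶ Q') :
    karoubiTensorObj P P' ⟶ karoubiTensorObj Q Q' where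
  f := f.f ⊗ₘ g.f
  comm := by simp [karoubiTensorObj, tensorHom_comp_tensorHom]

theorem InducedBy.tensor {P Q P' Q' : Karoubi C} {f : P ⟶ Q} {g : P' ⟶ Q'} {i : P.X ⟶ Q.X}
    {j : P'.X ⟶ Q'.X} (hf : InducedBy f i) (hg : InducedBy g j) :
    InducedBy (karoubiTensorHom f g) (i ⊗ₘ j) := by
  refine ⟨?_, ?_⟩
  · change f.f ⊗ₘ g.f = (_ ⊗ₘ _) ≫ _
    rw [hf.1, hg.1, tensorHom_comp_tensorHom]
  · change (P.p ⊗ₘ P'.p) ≫ _ = _ ≫ (Q.p ⊗ₘ Q'.p)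
    rw [tensorHom_comp_tensorHom, tensorHom_comp_tensorHom, hf.2, hg.2]

/-- The associator. -/
def karoubiAssoc (P Q R : Karoubi C) :
    karoubiTensorObj (karoubiTensorObj P Q) R ≅ karoubiTensorObj P (karoubiTensorObj Q R) :=
  karoubiIso (α_ P.X Q.X R.X) (associator_naturality _ _ _)

/-- The unit object. -/
abbrev karoubiUnit (C : Type u) [Category.{v} C] [MonoidalCategory C] : Karoubi C :=
  ⟨𝟙_ C, 𝟙 _, by simp⟩

/-- The left unitor. -/
def karoubiLeftUnitor (P : Karoubi C) : karoubiTensorObj (karoubiUnit C) P ≅ P :=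
  karoubiIso (λ_ P.X) (by simp)

/-- The right unitor. -/
def karoubiRightUnitor (P : Karoubi C) : karoubiTensorObj P (karoubiUnit C) ≅ P :=
  karoubiIso (ρ_ P.X) (by simp)

/-- The braiding. -/
def karoubiBraiding [BraidedCategory C] (P Q : Karoubi C) :
    karoubiTensorObj P Q ≅ karoubiTensorObj Q P :=
  karoubiIso (β_ P.X Q.X) (BraidedCategory.braiding_naturality P.p Q.p)

theorem karoubiAssoc_hom (P Q R : Karoubi C) :
    InducedBy (karoubiAssoc P Q R).hom (α_ P.X Q.X R.X).hom := .iso_hom _ _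

theorem karoubiAssoc_inv (P Q R : Karoubi C) :
    InducedBy (karoubiAssoc P Q R).inv (α_ P.X Q.X R.X).inv := .iso_inv _ _

theorem karoubiLeftUnitor_hom (P : Karoubi C) :
    InducedBy (karoubiLeftUnitor P).hom (λ_ P.X).hom := .iso_hom _ _

theorem karoubiRightUnitor_hom (P : Karoubi C) :
    InducedBy (karoubiRightUnitor P).hom (ρ_ P.X).hom := .iso_hom _ _

theorem karoubiBraiding_hom [BraidedCategory C] (P Q : Karoubi C) :
    InducedBy (karoubiBraiding P Q).hom (β_ P.X Q.X).hom := .iso_hom _ _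

instance : MonoidalCategoryStruct (Karoubi C) where
  tensorObj := karoubiTensorObj
  tensorHom := karoubiTensorHom
  whiskerLeft X _ _ f := karoubiTensorHom (𝟙 X) f
  whiskerRight f Y := karoubiTensorHom f (𝟙 Y)
  tensorUnit := ⟨𝟙_ C, 𝟙 _, by simp⟩
  associator P Q R := karoubiAssoc P Q R
  leftUnitor P := karoubiLeftUnitor P
  rightUnitor P := karoubiRightUnitor P

instance : MonoidalCategory (Karoubi C) :=
  MonoidalCategory.ofTensorHom
    (id_tensorHom_id := fun _ _ => rfl)
    (id_tensorHom := fun _ _ _ _ => rfl)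
    (tensorHom_id := fun _ _ => rfl)
    (tensorHom_comp_tensorHom := fun f₁ f₂ g₁ g₂ => by
      ext
      exact tensorHom_comp_tensorHom f₁.f f₂.f g₁.f g₂.f)
    (associator_naturality := fun f₁ f₂ f₃ =>
      (karoubiAssoc_hom _ _ _).naturality (karoubiAssoc_hom _ _ _) _ _
      (associator_naturality f₁.f f₂.f f₃.f))
    (leftUnitor_naturality := fun f =>
      (karoubiLeftUnitor_hom _).naturality (karoubiLeftUnitor_hom _) _ _
      ((congrArg (· ≫ _) (id_tensorHom _ f.f)).trans (leftUnitor_naturality f.f)))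
    (rightUnitor_naturality := fun f =>
      (karoubiRightUnitor_hom _).naturality (karoubiRightUnitor_hom _) _ _
      ((congrArg (· ≫ _) (tensorHom_id f.f _)).trans (rightUnitor_naturality f.f)))
    (pentagon := fun W X Y Z =>
      (((karoubiAssoc_hom W X Y).tensor (.id Z)).comp
        ((karoubiAssoc_hom W (karoubiTensorObj X Y) Z).comp
          ((InducedBy.id W).tensor (karoubiAssoc_hom X Y Z)))).eq
        ((karoubiAssoc_hom (karoubiTensorObj W X) Y Z).comp
          (karoubiAssoc_hom W X (karoubiTensorObj Y Z)))
        (by simp : ((α_ _ _ _).hom ⊗ₘ 𝟙 _) ≫ (α_ _ _ _).hom ≫ (𝟙 _ ⊗ₘ (α_ _ _ _).hom) =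
          (α_ (W.X ⊗ X.X) Y.X Z.X).hom ≫ (α_ W.X X.X (Y.X ⊗ Z.X)).hom))
    (triangle := fun X Y =>
      ((karoubiAssoc_hom X (karoubiUnit C) Y).comp
        ((InducedBy.id X).tensor (karoubiLeftUnitor_hom Y))).eq
        ((karoubiRightUnitor_hom X).tensor (.id Y))
        (by simp : (α_ X.X (𝟙_ C) Y.X).hom ≫ (𝟙 _ ⊗ₘ (λ_ Y.X).hom) = ((ρ_ X.X).hom ⊗ₘ 𝟙 _)))

instance [BraidedCategory C] : BraidedCategory (Karoubi C) where
  braiding P Q := karoubiBraiding P Q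
  braiding_naturality_right X _ _ f := (karoubiBraiding_hom _ _).naturality (karoubiBraiding_hom _ _) _ _
    (BraidedCategory.braiding_naturality X.p f.f)
  braiding_naturality_left f Z := (karoubiBraiding_hom _ _).naturality (karoubiBraiding_hom _ _) _ _
    (BraidedCategory.braiding_naturality f.f Z.p)
  hexagon_forward X Y Z :=
    ((karoubiAssoc_hom X Y Z).comp ((karoubiBraiding_hom X (karoubiTensorObj Y Z)).comp
      (karoubiAssoc_hom Y Z X))).eq
      (((karoubiBraiding_hom X Y).tensor (.id Z)).comp ((karoubiAssoc_hom Y X Z).comp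
        ((InducedBy.id Y).tensor (karoubiBraiding_hom X Z))))
      ((BraidedCategory.hexagon_forward X.X Y.X Z.X).trans
        (by rw [tensorHom_id, id_tensorHom]))
  hexagon_reverse X Y Z :=
    ((karoubiAssoc_inv X Y Z).comp ((karoubiBraiding_hom (karoubiTensorObj X Y) Z).comp
      (karoubiAssoc_inv Z X Y))).eq
      (((InducedBy.id X).tensor (karoubiBraiding_hom Y Z)).comp ((karoubiAssoc_inv X Z Y).comp
        ((karoubiBraiding_hom X Z).tensor (.id Y))))
      ((BraidedCategory.hexagon_reverse X.X Y.X Z.X).trans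
        (by rw [tensorHom_id, id_tensorHom]))

instance [SymmetricCategory C] : SymmetricCategory (Karoubi C) where
  symmetry P Q := ((karoubiBraiding_hom P Q).comp (karoubiBraiding_hom Q P)).eq (.id _)
    (SymmetricCategory.symmetry P.X Q.X)

end KaroubiMonoidal

section Slice

variable {A : Type u} [Category.{v} A] {x₀ : A}

theorem over_isPullback_iff {P X Y Z : Over x₀} {p : P ⟶ X} {q : P ⟶ Y} {f : X ⟶ Z} {g : Y ⟶ Z} :
    IsPullback p q f g ↔ IsPullback p.left q.left f.left g.left := by
  constructor
  · intro h
    exact h.map (Over.forget x₀)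
  · intro h
    exact IsPullback.of_map (Over.forget x₀) (by ext; exact h.w) h

theorem over_hasPullback {X Y Z : Over x₀} (f : X ⟶ Z) (g : Y ⟶ Z) [HasPullback f.left g.left] :
    HasPullback f g := by
  let P : Over x₀ := Over.mk (pullback.fst f.left g.left ≫ X.hom)
  let p : P ⟶ X := Over.homMk (pullback.fst f.left g.left)
  let q : P ⟶ Y := Over.homMk (pullback.snd f.left g.left) (by
    rw [← Over.w g, ← Category.assoc, ← pullback.condition]
    simp [P])
  have h : IsPullback p q f g := over_isPullback_iff.mpr (IsPullback.of_hasPullback _ _)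
  exact h.hasPullback

variable [KnopRegular A]

theorem over_extremalEpi_iff {X Y : Over x₀} (e : X ⟶ Y) : ExtremalEpi e ↔ ExtremalEpi e.left := by
  constructor
  · intro h
    let m : Over.mk (image.ι e.left ≫ Y.hom) ⟶ Y := Over.homMk (image.ι e.left)
    let p : X ⟶ Over.mk (image.ι e.left ≫ Y.hom) := Over.homMk (factorThruImage e.left)
    have : Mono m.left := inferInstanceAs (Mono (image.ι e.left))
    have : Mono m := Over.mono_of_mono_left m
    have := ExtremalEpi.isIso e p m (by ext; exact image.fac _)
    have : IsIso (image.ι e.left) := inferInstanceAs (IsIso ((Over.forget x₀).map m))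
    rw [← image.fac e.left]
    infer_instance
  · intro h
    have : Epi e := Over.epi_of_epi_left e
    refine ⟨fun p i fac hi => ?_⟩
    have := ExtremalEpi.isIso e.left p.left i.left (by rw [← Over.comp_left, fac])
    have : IsIso ((Over.forget x₀).map i) := this
    exact isIso_of_reflects_iso i (Over.forget x₀)

/-- The image factorisation in a slice category. -/
noncomputable def overMonoFactorisation {X Y : Over x₀} (f : X ⟶ Y) : MonoFactorisation f where
  I := Over.mk (image.ι f.left ≫ Y.hom)
  m := Over.homMk (image.ι f.left)
  e := Over.homMk (factorThruImage f.left)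

/-- The factorisation in `A` underlying a factorisation in a slice category. -/
def overFactorisationLeft {X Y : Over x₀} {f : X ⟶ Y} (F : MonoFactorisation f) :
    MonoFactorisation f.left where
  I := F.I.left
  m := F.m.left
  e := F.e.left
  fac := by rw [← Over.comp_left, F.fac]

/-- The image factorisation in a slice category is the image. -/
noncomputable def overIsImage {X Y : Over x₀} (f : X ⟶ Y) : IsImage (overMonoFactorisation f) where
  lift F := Over.homMk (image.lift (overFactorisationLeft F)) (by
    have h : image.lift (overFactorisationLeft F) ≫ F.m.left = image.ι f.left :=
      image.lift_fac (overFactorisationLeft F)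
    rw [← Over.w F.m]
    exact (Category.assoc _ _ _).symm.trans (congrArg (· ≫ Y.hom) h))
  lift_fac F := by
    ext
    exact image.lift_fac _

instance : KnopRegular (Over x₀) where
  hasTerminal := inferInstance
  hasImages := ⟨fun f => ⟨⟨⟨overMonoFactorisation f, overIsImage f⟩⟩⟩⟩
  hasPullback_of_commSq p q f g h := by
    have := KnopRegular.hasPullback_of_commSq p.left q.left f.left g.left
      (by rw [← Over.comp_left, h, Over.comp_left])
    exact over_hasPullback f g
  hasPullback_of_extremalEpi f g h := by
    have := (over_extremalEpi_iff f).1 h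
    have := KnopRegular.hasPullback_of_extremalEpi f.left g.left
    exact over_hasPullback f g
  extremalEpi_of_isPullback h hf := (over_extremalEpi_iff _).2
    (KnopRegular.extremalEpi_of_isPullback (over_isPullback_iff.1 h) ((over_extremalEpi_iff _).1 hf))

/-- The degree function induced on the slice category `A/x₀`. -/
def DegreeFunction.over {K : Type w} [CommRing K] (δ : DegreeFunction A K) (x₀ : A) :
    DegreeFunction (Over x₀) K where
  deg e h := haveI := (over_extremalEpi_iff e).1 h; δ.deg e.left
  deg_id x := δ.deg_id x.left
  deg_comp e e' h h' h'' := by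
    have := (over_extremalEpi_iff _).1 h
    have := (over_extremalEpi_iff _).1 h'
    have : ExtremalEpi (e.left ≫ e'.left) := (over_extremalEpi_iff _).1 h''
    exact δ.deg_comp e.left e'.left
  deg_pullback {_ _ _ _ _ snd e _} h h' hp := by
    have := (over_extremalEpi_iff e).1 h
    have := (over_extremalEpi_iff snd).1 h'
    exact δ.deg_pullback (over_isPullback_iff.1 hp)

end Slice

/-- Knop's tensor category `T(A, δ)`: the additive Karoubi completion of `T⁰(A, δ)`. -/
abbrev T {A : Type u} [Category.{v} A] [KnopRegular A] {K : Type w} [CommRing K]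
    (δ : DegreeFunction A K) : Type _ :=
  Idempotents.Karoubi (Mat_ (T0 δ))

section Functoriality

variable {A : Type u} [Category.{v} A] {B : Type (max u v)} [Category.{v} B] [KnopRegular A]
  [KnopRegular B] {K : Type w} [CommRing K]

/-- The properties of a functor needed to transport relations and their composition: it preserves
jointly monic pairs, pullbacks, extremal epimorphisms and their degrees, and reflects the existence
of pullbacks. -/
structure PreservesRelations (F : A ⥤ B) (δ : DegreeFunction A K) (δ' : DegreeFunction B K) :
    Prop where
  jointlyMono : ∀ {x y : A} (r : RelSpan x y) {w : B} (g h : w ⟶ F.obj r.apex),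
    g ≫ F.map r.fst = h ≫ F.map r.fst → g ≫ F.map r.snd = h ≫ F.map r.snd → g = h
  isPullback : ∀ {p x y z : A} {fst : p ⟶ x} {snd : p ⟶ y} {f : x ⟶ z} {g : y ⟶ z},
    IsPullback fst snd f g → IsPullback (F.map fst) (F.map snd) (F.map f) (F.map g)
  hasPullback : ∀ {x y z : A} (f : x ⟶ z) (g : y ⟶ z), HasPullback (F.map f) (F.map g) →
    HasPullback f g
  extremalEpi : ∀ {x y : A} (e : x ⟶ y), ExtremalEpi e → ExtremalEpi (F.map e)
  deg : ∀ {x y : A} (e : x ⟶ y) [ExtremalEpi e] [ExtremalEpi (F.map e)],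
    δ'.deg (F.map e) = δ.deg e

namespace PreservesRelations

variable {F : A ⥤ B} {δ : DegreeFunction A K} {δ' : DegreeFunction B K}

/-- The image of a relation `r` between `x` and `y` as a relation between `F x` and `F y`. -/
def mapSpan (hF : PreservesRelations F δ δ') {x y : A} (r : RelSpan x y) : RelSpan (F.obj x) (F.obj y) where
  apex := F.obj r.apex
  fst := F.map r.fst
  snd := F.map r.snd
  jointlyMono g h := hF.jointlyMono r g h

/-- The map `⟨r⟩ ↦ ⟨F r⟩`. -/
def mapRel (hF : PreservesRelations F δ δ') {x y : A} : Relation x y → Relation (F.obj x) (F.obj y) :=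
  Quotient.map hF.mapSpan fun _ _ ⟨i, h1, h2⟩ => ⟨F.mapIso i,
    by simp [mapSpan, ← h1], by simp [mapSpan, ← h2]⟩

/-- The linear extension of `⟨r⟩ ↦ ⟨F r⟩`. -/
noncomputable def mapLin (hF : PreservesRelations F δ δ') (x y : A) :
    (Relation x y →₀ K) →ₗ[K] (Relation (F.obj x) (F.obj y) →₀ K) :=
  Finsupp.lmapDomain K K hF.mapRel

theorem mapLin_span (hF : PreservesRelations F δ δ') {x y p : A} (a : p ⟶ x) (b : p ⟶ y) :
    hF.mapLin x y (spanClass δ a b) = spanClass δ' (F.map a) (F.map b) := by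
  obtain ⟨r, e, _, rfl, rfl⟩ := exists_factor a b
  have := hF.extremalEpi e inferInstance
  have : ExtremalEpi (Y := (hF.mapSpan r).apex) (F.map e) := this
  rw [spanClass_eq_single, F.map_comp, F.map_comp]
  refine Eq.trans ?_ (spanClass_eq_single δ' (hF.mapSpan r) (F.map e)).symm
  rw [← hF.deg e]
  exact Finsupp.mapDomain_single

theorem mapLin_comp (hF : PreservesRelations F δ δ') {x y z : A} (f : Relation x y →₀ K) (g : Relation y z →₀ K) :
    hF.mapLin x z (compLin δ x y z f g) =
      compLin δ' _ _ _ (hF.mapLin x y f) (hF.mapLin y z g) := by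
  induction f using hom_induction δ with
  | zero => simp
  | add f f' hf hf' => simp only [map_add, LinearMap.add_apply, hf, hf']
  | span k a b =>
    induction g using hom_induction δ with
    | zero => simp
    | add f f' hf hf' => simp only [map_add, hf, hf']
    | span l c d =>
      simp only [map_smul, LinearMap.smul_apply, mapLin_span]
      by_cases h : HasPullback b c
      · have h' := IsPullback.of_hasPullback b c
        rw [compLin_span δ a d h', compLin_span δ' _ _ (hF.isPullback h'), mapLin_span]
        simp
      · rw [compLin_span_of_forall, compLin_span_of_forall, map_zero]
        · intro w f g hfg
          exact h (hF.hasPullback b c (KnopRegular.hasPullback_of_commSq f g _ _ hfg))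
        · intro w f g hfg
          exact h (KnopRegular.hasPullback_of_commSq f g _ _ hfg)

/-- The functor `T⁰(A, δ) ⥤ T⁰(B, δ')` with `[x] ↦ [F x]` and `⟨r⟩ ↦ ⟨F r⟩`. -/
noncomputable def mapT0 (hF : PreservesRelations F δ δ') : T0 δ ⥤ T0 δ' where
  obj X := T0.of (F.obj X.obj)
  map {X Y} f := hF.mapLin X.obj Y.obj f
  map_id X := by
    refine (hF.mapLin_span (𝟙 X.obj) (𝟙 X.obj)).trans ?_
    rw [F.map_id]
    rfl
  map_comp f g := hF.mapLin_comp f g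

instance (hF : PreservesRelations F δ δ') : hF.mapT0.Additive where
  map_add {X Y f g} := map_add (hF.mapLin X.obj Y.obj) f g

/-- The functor `T(A, δ) ⥤ T(B, δ')` induced by `F`: the extension of `mapT0` to the additive
Karoubi completions. -/
noncomputable def mapT (hF : PreservesRelations F δ δ') : T δ ⥤ T δ' :=
  (Idempotents.functorExtension₂ (Mat_ (T0 δ)) (Mat_ (T0 δ'))).obj hF.mapT0.mapMat_

end PreservesRelations

end Functoriality

section ProdOver

variable {A : Type u} [Category.{v} A] (x₀ : A) [∀ x : A, HasBinaryProduct x x₀]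

/-- The functor `(-) × x₀ : A ⥤ A/x₀`. -/
noncomputable def prodOver : A ⥤ Over x₀ where
  obj x := Over.mk (prod.snd : x ⨯ x₀ ⟶ x₀)
  map f := Over.homMk (prod.map f (𝟙 x₀))
  map_id x := by
    ext
    exact prod.map_id_id
  map_comp f g := by
    ext
    simp

/-- The projection `x ⨯ x₀ ⟶ x`, the counit of the adjunction with the forgetful functor. -/
noncomputable def prodOverFst (x : A) : ((prodOver x₀).obj x).left ⟶ x :=
  (prod.fst : x ⨯ x₀ ⟶ x)

theorem prodOver_map_left_fst {x y : A} (f : x ⟶ y) :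
    ((prodOver x₀).map f).left ≫ prodOverFst x₀ y = prodOverFst x₀ x ≫ f :=
  prod.map_fst _ _

theorem prodOver_hom_ext {w : Over x₀} {x : A} {g h : w ⟶ (prodOver x₀).obj x}
    (e : g.left ≫ prodOverFst x₀ x = h.left ≫ prodOverFst x₀ x) : g = h := by
  apply Over.OverMorphism.ext
  exact prod.hom_ext e ((Over.w g).trans (Over.w h).symm)

variable [KnopRegular A] {K : Type w} [CommRing K] (δ : DegreeFunction A K)

theorem isPullback_prodOver {p x y z : A} {fst : p ⟶ x} {snd : p ⟶ y} {f : x ⟶ z} {g : y ⟶ z}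
    (h : IsPullback fst snd f g) : IsPullback ((prodOver x₀).map fst) ((prodOver x₀).map snd)
      ((prodOver x₀).map f) ((prodOver x₀).map g) :=
  over_isPullback_iff.2 (isPullback_prodMap h (IsPullback.id_horiz (𝟙 x₀)))

theorem isPullback_prodMap_fst {x y : A} (f : x ⟶ y) :
    IsPullback (prod.fst : x ⨯ x₀ ⟶ x) (prod.map f (𝟙 x₀)) f prod.fst := by
  refine IsPullback.mk' ?_ ?_ ?_
  · simp
  · intro w g h h1 h2
    ext
    · exact h1
    · simpa using h2 =≫ prod.snd
  · intro w a b h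
    refine ⟨prod.lift a (b ≫ prod.snd), prod.lift_fst _ _, ?_⟩
    ext <;> simp [prod.lift_fst, prod.lift_snd, h]

/-- The functor `(-) × x₀` transports relations, with respect to the induced degree function. -/
theorem prodOver_preservesRelations : PreservesRelations (prodOver x₀) δ (δ.over x₀) where
  jointlyMono r w g h h1 h2 := by
    have key : ∀ {t : A} (k : r.apex ⟶ t), g ≫ (prodOver x₀).map k = h ≫ (prodOver x₀).map k →
        (g.left ≫ prodOverFst x₀ _) ≫ k = (h.left ≫ prodOverFst x₀ _) ≫ k := by
      intro t k hk
      have e := congrArg (fun l => CommaMorphism.left l ≫ prodOverFst x₀ _) hk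
      simpa only [Over.comp_left, Category.assoc, prodOver_map_left_fst] using e
    exact prodOver_hom_ext x₀ (r.jointlyMono _ _ (key _ h1) (key _ h2))
  isPullback h := isPullback_prodOver x₀ h
  hasPullback f g h := by
    have c := congrArg (fun l => CommaMorphism.left l ≫ prodOverFst x₀ _)
      (pullback.condition (f := (prodOver x₀).map f) (g := (prodOver x₀).map g))
    simp only [Over.comp_left, Category.assoc, prodOver_map_left_fst] at c
    simp only [← Category.assoc] at c
    exact KnopRegular.hasPullback_of_commSq _ _ f g c
  extremalEpi e h := (over_extremalEpi_iff _).2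
    (KnopRegular.extremalEpi_of_isPullback (isPullback_prodMap_fst x₀ e) h)
  deg e _ h := by
    have : ExtremalEpi ((prodOver x₀).map e).left := (over_extremalEpi_iff _).1 h
    exact δ.deg_pullback (isPullback_prodMap_fst x₀ e)

/-- The functor `T(A, δ) ⥤ T(A/x₀, δ')` induced by `(-) × x₀`, with `δ'` the induced degree
function on `A/x₀`. -/
noncomputable abbrev prodOverBar : T δ ⥤ T (δ.over x₀) := (prodOver_preservesRelations x₀ δ).mapT

end ProdOver

section Vect

/-- Abelian categories are regular. -/
theorem knopRegular_of_abelian {A : Type u} [Category.{v} A] [Abelian A] : KnopRegular A where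
  hasTerminal := inferInstance
  hasImages := inferInstance
  hasPullback_of_commSq _ _ _ _ _ := inferInstance
  hasPullback_of_extremalEpi _ _ := inferInstance
  extremalEpi_of_isPullback h _ := by
    have := Abelian.epi_snd_of_isLimit _ _ h.isLimit
    have := strongEpi_of_epi (h.cone.snd)
    exact inferInstanceAs (ExtremalEpi h.cone.snd)

variable {k : Type u'} [Field k]

/-- The category of finite dimensional vector spaces is regular. -/
instance : KnopRegular (FGModuleCat.{u'} k) := knopRegular_of_abelian

theorem vect_surjective {x y : FGModuleCat.{u'} k} (e : x ⟶ y) [Epi e] :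
    Function.Surjective e.hom.hom := by
  have : Epi ((forget₂ (FGModuleCat k) (ModuleCat k)).map e) := inferInstance
  exact (ModuleCat.epi_iff_surjective _).1 this

/-- The dimension of the kernel of a linear map. -/
noncomputable def dimKer {x y : FGModuleCat.{u'} k} (e : x ⟶ y) : ℕ :=
  Module.finrank k (LinearMap.ker e.hom.hom)

theorem dimKer_add {x y : FGModuleCat.{u'} k} (e : x ⟶ y) [Epi e] :
    dimKer e + Module.finrank k y = Module.finrank k x := by
  have h := LinearMap.finrank_range_add_finrank_ker e.hom.hom
  rw [LinearMap.range_eq_top.2 (vect_surjective e), finrank_top, add_comm] at h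
  exact h

theorem dimKer_isPullback {p x y z : FGModuleCat.{u'} k} {fst : p ⟶ x} {snd : p ⟶ y} {e : x ⟶ z}
    {g : y ⟶ z} (h : IsPullback fst snd e g) : dimKer snd = dimKer e := by
  have w : ∀ a : p, e.hom.hom (fst.hom.hom a) = g.hom.hom (snd.hom.hom a) := fun a =>
    congrArg (fun l : p ⟶ z => l.hom.hom a) h.w
  let φ : LinearMap.ker snd.hom.hom →ₗ[k] LinearMap.ker e.hom.hom :=
    fst.hom.hom.restrict fun a ha => by
      rw [LinearMap.mem_ker] at ha ⊢
      rw [w, ha, map_zero]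
  refine LinearEquiv.finrank_eq (LinearEquiv.ofBijective φ ⟨?_, ?_⟩)
  · rw [← LinearMap.ker_eq_bot, LinearMap.ker_eq_bot']
    rintro ⟨a, ha⟩ ha'
    have hf : fst.hom.hom a = 0 := congrArg Subtype.val ha'
    let N : Submodule k p := LinearMap.ker fst.hom.hom ⊓ LinearMap.ker snd.hom.hom
    let j : FGModuleCat.of k N ⟶ p := FGModuleCat.ofHom N.subtype
    have hj : j = 0 := by
      apply h.hom_ext
      · ext ⟨b, hb⟩
        exact Eq.trans (b := (0 : x)) hb.1 (zero_comp (f := fst) ▸ rfl)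
      · ext ⟨b, hb⟩
        exact Eq.trans (b := (0 : y)) hb.2 (zero_comp (f := snd) ▸ rfl)
    ext
    exact congrArg (fun l : FGModuleCat.of k N ⟶ p => l.hom.hom ⟨a, hf, ha⟩) hj
  · rintro ⟨a, ha⟩
    let N : Submodule k x := LinearMap.ker e.hom.hom
    let j : FGModuleCat.of k N ⟶ x := FGModuleCat.ofHom N.subtype
    have hj : j ≫ e = (0 : FGModuleCat.of k N ⟶ y) ≫ g := by
      ext ⟨b, hb⟩
      exact hb.trans (map_zero g.hom.hom).symm
    refine ⟨⟨(h.lift j 0 hj).hom.hom ⟨a, ha⟩, ?_⟩, ?_⟩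
    · exact congrArg (fun l : FGModuleCat.of k N ⟶ y => l.hom.hom ⟨a, ha⟩) (h.lift_snd j 0 hj)
    · ext
      exact congrArg (fun l : FGModuleCat.of k N ⟶ x => l.hom.hom ⟨a, ha⟩) (h.lift_fst j 0 hj)

/-- The degree function `δ_t(e) = t ^ dim (ker e)` on finite dimensional vector spaces. -/
noncomputable def vectDegree (k : Type u') [Field k] {K : Type w} [CommRing K] (t : K) :
    DegreeFunction (FGModuleCat.{u'} k) K where
  deg e _ := t ^ dimKer e
  deg_id x := by
    have := dimKer_add (𝟙 x)
    rw [show dimKer (𝟙 x) = 0 by lia, pow_zero]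
  deg_comp e e' _ _ _ := by
    have h1 := dimKer_add e
    have h2 := dimKer_add e'
    have h3 := dimKer_add (e ≫ e')
    rw [← pow_add]
    congr 1
    lia
  deg_pullback h := by rw [dimKer_isPullback h]

end Vect

/-- The category `Rep(GL_t(F_q)) = T(Vect_{F_q}, δ_t)`. -/
abbrev RepGL (k : Type u') [Field k] {K : Type w} [CommRing K] (t : K) : Type _ :=
  T (vectDegree k t)

end DeligneKnop

/-!
The functor `F = (-) × x₀ : A ⥤ A/x₀` is right adjoint to the forgetful functor `G`, with unit the
graph `x → x × x₀` of the structure map and counit the projection `x × x₀ → x`. The naturality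
squares of the counit are Cartesian, and so are those of the unit, because pasting the two gives a
square of identities. In particular `F` preserves all limits.

Composing the graph of a morphism `f : x ⟶ y` with a relation amounts to pulling the relation back
along `f`. Hence a natural transformation with Cartesian naturality squares remains natural, after
passing to graphs, with respect to arbitrary relations instead of morphisms only, and even linear
combinations of relations (`graph_prodOverUnit_naturality`, `graph_prodOverFst_naturality`). Since
`G` also transports relations and their composition, the adjunction `G ⊣ F` induces an adjunction
between the categories `T⁰` (`forgetT0Adj`). Adjunctions extend to additive and to Karoubi
completions (`matAdjunction`, `karoubiAdjunction`), so the functor `T(A, δ) ⥤ T(A/x₀, δ')` is a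
right adjoint and preserves every limit that exists (`preservesFiniteLimits_prodOverBar`).

For the symmetric monoidal structure it suffices that `F` preserves finite limits and reflects the
existence of products: the comparison isomorphisms `F (x ⨯ y) ⟶ F x ⨯ F y` are natural with respect
to relations (`PreservesRelations.mapLin_tensLin`), the family of those products that exist is
indexed in the same way on both sides, and the coherence conditions reduce to identities between
maps into products. The structure passes to the Karoubi completion (`karoubiBraided`).
-/

namespace DeligneKnop

/-! ### The adjunction between the slice category and `A` -/

section ProdOverAdjunction

variable {A : Type u} [Category.{v} A] (x₀ : A) [∀ x : A, HasBinaryProduct x x₀]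

/-- The unit of the adjunction at `X = (x → x₀)`: the graph `x → x × x₀` of the structure map. -/
noncomputable def prodOverUnit (X : Over x₀) : X ⟶ (prodOver x₀).obj X.left :=
  Over.homMk (prod.lift (𝟙 X.left) X.hom) (prod.lift_snd _ _)

theorem prodOverUnit_left_fst (X : Over x₀) :
    (prodOverUnit x₀ X).left ≫ prodOverFst x₀ X.left = 𝟙 X.left :=
  prod.lift_fst _ _

theorem prodOverUnit_naturality {X Y : Over x₀} (f : X ⟶ Y) :
    f ≫ prodOverUnit x₀ Y = prodOverUnit x₀ X ≫ (prodOver x₀).map f.left := by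
  apply prodOver_hom_ext
  rw [Over.comp_left, Over.comp_left, Category.assoc, Category.assoc, prodOver_map_left_fst,
    prodOverUnit_left_fst, Category.comp_id, ← Category.assoc, prodOverUnit_left_fst,
    Category.id_comp]

theorem prodOverUnit_map_fst (x : A) :
    prodOverUnit x₀ ((prodOver x₀).obj x) ≫ (prodOver x₀).map (prodOverFst x₀ x) = 𝟙 _ := by
  apply prodOver_hom_ext
  rw [Over.comp_left, Category.assoc, prodOver_map_left_fst, ← Category.assoc,
    prodOverUnit_left_fst, Over.id_left]

/-- The functor `(-) × x₀` is right adjoint to the forgetful functor `A/x₀ ⥤ A`. -/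
noncomputable def forgetAdjProdOver : Over.forget x₀ ⊣ prodOver x₀ where
  unit :=
    { app := prodOverUnit x₀
      naturality := fun _ _ f => prodOverUnit_naturality x₀ f }
  counit :=
    { app := prodOverFst x₀
      naturality := fun _ _ f => prodOver_map_left_fst x₀ f }
  left_triangle_components X := prodOverUnit_left_fst x₀ X
  right_triangle_components x := prodOverUnit_map_fst x₀ x

variable [KnopRegular A]

theorem isPullback_prodOverFst {x y : A} (f : x ⟶ y) :
    IsPullback ((prodOver x₀).map f).left (prodOverFst x₀ x) (prodOverFst x₀ y) f :=
  (isPullback_prodMap_fst x₀ f).flip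

/-- Composing the naturality square of the unit with that of the counit yields a square of
identities, so the former is Cartesian as the latter is. -/
theorem isPullback_prodOverUnit {X Y : Over x₀} (f : X ⟶ Y) :
    IsPullback f (prodOverUnit x₀ X) (prodOverUnit x₀ Y) ((prodOver x₀).map f.left) := by
  refine over_isPullback_iff.2 (IsPullback.of_bot (t := isPullback_prodOverFst x₀ f.left) ?_
    (congrArg CommaMorphism.left (prodOverUnit_naturality x₀ f)))
  rw [prodOverUnit_left_fst, prodOverUnit_left_fst]
  exact IsPullback.id_vert f.left

theorem forgetAdjProdOver_unit_equifibered :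
    NatTrans.Equifibered (forgetAdjProdOver x₀).unit :=
  fun _ _ f => isPullback_prodOverUnit x₀ f

theorem forgetAdjProdOver_counit_equifibered :
    NatTrans.Equifibered (forgetAdjProdOver x₀).counit :=
  fun _ _ f => isPullback_prodOverFst x₀ f

end ProdOverAdjunction

/-! ### The adjunction on categories of relations -/

section T0Adjunction

variable {A : Type u} [Category.{v} A] [KnopRegular A] {K : Type w} [CommRing K]
  {δ : DegreeFunction A K}

/-- If the square formed by `a`, `e`, `f` and `c` is Cartesian, the graph of `f` followed by the
span `(c, d)` is the span `(a, e ≫ d)`. -/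
theorem compLin_graph_span_of_isPullback {x y z P Q : A} {f : x ⟶ y} {c : Q ⟶ y} (d : Q ⟶ z)
    {a : P ⟶ x} {e : P ⟶ Q} (h : IsPullback a e f c) :
    compLin δ x y z (spanClass δ (𝟙 x) f) (spanClass δ c d) = spanClass δ a (e ≫ d) := by
  rw [compLin_span δ _ _ h, Category.comp_id]

variable {x₀ : A}

/-- A relation in `A/x₀`, regarded as a relation in `A`. -/
def forgetSpan {X Y : Over x₀} (r : RelSpan X Y) : RelSpan X.left Y.left where
  apex := r.apex.left
  fst := r.fst.left
  snd := r.snd.left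
  jointlyMono {w} g h h1 h2 := by
    -- Both `g` and `h` are morphisms over `x₀` for the structure map `g ≫ r.apex.hom` of `w`.
    let g' : Over.mk (g ≫ r.apex.hom) ⟶ r.apex := Over.homMk g
    let h' : Over.mk (g ≫ r.apex.hom) ⟶ r.apex := Over.homMk h (by
      rw [← Over.w r.fst, ← Category.assoc, ← Category.assoc, h1]
      rfl)
    exact congrArg CommaMorphism.left
      (r.jointlyMono g' h' (by ext; exact h1) (by ext; exact h2))

/-- The map on relations induced by the forgetful functor `A/x₀ ⥤ A`. -/
def forgetRel {X Y : Over x₀} : Relation X Y → Relation X.left Y.left :=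
  Quotient.map forgetSpan fun _ _ ⟨i, h1, h2⟩ => ⟨(Over.forget x₀).mapIso i,
    congrArg CommaMorphism.left h1, congrArg CommaMorphism.left h2⟩

/-- The linear extension of `forgetRel`. -/
noncomputable def forgetLin (X Y : Over x₀) :
    (Relation X Y →₀ K) →ₗ[K] (Relation X.left Y.left →₀ K) :=
  Finsupp.lmapDomain K K forgetRel

theorem forgetLin_span {X Y P : Over x₀} (a : P ⟶ X) (b : P ⟶ Y) :
    forgetLin X Y (spanClass (δ.over x₀) a b) = spanClass δ a.left b.left := by
  obtain ⟨r, e, _, rfl, rfl⟩ := exists_factor a b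
  have : ExtremalEpi (Y := (forgetSpan r).apex) e.left := (over_extremalEpi_iff e).1 inferInstance
  rw [spanClass_eq_single, Over.comp_left, Over.comp_left]
  exact Finsupp.mapDomain_single.trans (spanClass_eq_single δ (forgetSpan r) e.left).symm

theorem forgetLin_comp {X Y Z : Over x₀} (f : Relation X Y →₀ K) (g : Relation Y Z →₀ K) :
    forgetLin X Z (compLin (δ.over x₀) X Y Z f g) =
      compLin δ _ _ _ (forgetLin X Y f) (forgetLin Y Z g) := by
  induction f using hom_induction (δ.over x₀) with
  | zero => simp
  | add f f' hf hf' => simp only [map_add, LinearMap.add_apply, hf, hf']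
  | span k a b =>
    induction g using hom_induction (δ.over x₀) with
    | zero => simp
    | add f f' hf hf' => simp only [map_add, hf, hf']
    | span l c d =>
      simp only [map_smul, LinearMap.smul_apply, forgetLin_span]
      by_cases h : HasPullback b c
      · have h' := IsPullback.of_hasPullback b c
        rw [compLin_span (δ.over x₀) a d h', compLin_span δ _ _ (over_isPullback_iff.1 h'),
          forgetLin_span]
        rfl
      · rw [compLin_span_of_forall, compLin_span_of_forall, map_zero]
        · intro w f g hfg
          have := KnopRegular.hasPullback_of_commSq _ _ _ _ hfg
          exact h (over_hasPullback b c)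
        · intro w f g hfg
          exact h (KnopRegular.hasPullback_of_commSq _ _ _ _ hfg)

variable (δ x₀) in
/-- The functor `T⁰(A/x₀, δ') ⥤ T⁰(A, δ)` induced by the forgetful functor. -/
noncomputable def forgetT0 : T0 (δ.over x₀) ⥤ T0 δ where
  obj X := T0.of X.obj.left
  map {X Y} f := forgetLin X.obj Y.obj f
  map_id X := forgetLin_span (𝟙 X.obj) (𝟙 X.obj)
  map_comp f g := forgetLin_comp f g

instance : (forgetT0 δ x₀).Additive where
  map_add {X Y f g} := map_add (forgetLin X.obj Y.obj) f g

theorem forgetT0_graph {X Y : T0 (δ.over x₀)} (f : X.obj ⟶ Y.obj) :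
    (forgetT0 δ x₀).map (T0.graph f) =
      T0.graph (X := T0.of X.obj.left) (Y := T0.of Y.obj.left) f.left :=
  forgetLin_span _ _

end T0Adjunction

namespace PreservesRelations

variable {A : Type u} [Category.{v} A] {B : Type (max u v)} [Category.{v} B] [KnopRegular A]
  [KnopRegular B] {K : Type w} [CommRing K] {F : A ⥤ B} {δ : DegreeFunction A K}
  {δ' : DegreeFunction B K}

theorem mapT0_graph (hF : PreservesRelations F δ δ') {X Y : T0 δ} (f : X.obj ⟶ Y.obj) :
    hF.mapT0.map (T0.graph f) =
      T0.graph (X := T0.of (F.obj X.obj)) (Y := T0.of (F.obj Y.obj)) (F.map f) := by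
  refine (hF.mapLin_span _ _).trans ?_
  rw [F.map_id]
  rfl

instance (hF : PreservesRelations F δ δ') : hF.mapT0.Linear K where
  map_smul {X Y} f r := map_smul (hF.mapLin X.obj Y.obj) r f

end PreservesRelations

section T0Adjunction

variable {A : Type u} [Category.{v} A] [KnopRegular A] {K : Type w} [CommRing K]
  (δ : DegreeFunction A K) (x₀ : A) [∀ x : A, HasBinaryProduct x x₀]

/-- Graphs of the unit are natural with respect to all relations, because the naturality squares
of the unit are Cartesian. -/
theorem graph_prodOverUnit_naturality {X Y : Over x₀} (f : Relation X Y →₀ K) :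
    compLin (δ.over x₀) X Y _ f (spanClass (δ.over x₀) (𝟙 Y) (prodOverUnit x₀ Y)) =
      compLin (δ.over x₀) X _ _ (spanClass (δ.over x₀) (𝟙 X) (prodOverUnit x₀ X))
        ((prodOver_preservesRelations x₀ δ).mapLin X.left Y.left (forgetLin X Y f)) := by
  induction f using hom_induction (δ.over x₀) with
  | zero => simp
  | add f g hf hg => simp only [map_add, LinearMap.add_apply, hf, hg]
  | span k a b =>
    simp only [map_smul, LinearMap.smul_apply]
    rw [forgetLin_span, PreservesRelations.mapLin_span, compLin_span_graph,
      compLin_graph_span_of_isPullback _ (isPullback_prodOverUnit x₀ a),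
      prodOverUnit_naturality]

/-- Graphs of the counit are natural with respect to all relations, because the naturality squares
of the counit are Cartesian. -/
theorem graph_prodOverFst_naturality {x y : A} (f : Relation x y →₀ K) :
    compLin δ _ _ y (forgetLin ((prodOver x₀).obj x) ((prodOver x₀).obj y)
        ((prodOver_preservesRelations x₀ δ).mapLin x y f))
        (spanClass δ (𝟙 _) (prodOverFst x₀ y)) =
      compLin δ _ x y (spanClass δ (𝟙 _) (prodOverFst x₀ x)) f := by
  induction f using hom_induction δ with
  | zero => simp
  | add f g hf hg => simp only [map_add, LinearMap.add_apply, hf, hg]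
  | span k a b =>
    simp only [map_smul, LinearMap.smul_apply]
    rw [PreservesRelations.mapLin_span, forgetLin_span, compLin_span_graph,
      compLin_graph_span_of_isPullback _ (isPullback_prodOverFst x₀ a), prodOver_map_left_fst]

/-- The functor induced by `(-) × x₀` on categories of relations is right adjoint to the one induced
by the forgetful functor; unit and counit are the graphs of those of the adjunction between `A/x₀`
and `A`. -/
noncomputable def forgetT0Adj : forgetT0 δ x₀ ⊣ (prodOver_preservesRelations x₀ δ).mapT0 where
  unit :=
    { app := fun X => T0.graph (Y := T0.of ((prodOver x₀).obj X.obj.left))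
        (prodOverUnit x₀ X.obj)
      naturality := fun _ _ f => graph_prodOverUnit_naturality δ x₀ f }
  counit :=
    { app := fun X => T0.graph (X := T0.of ((prodOver x₀).obj X.obj).left) (prodOverFst x₀ X.obj)
      naturality := fun _ _ f => graph_prodOverFst_naturality δ x₀ f }
  left_triangle_components X := by
    refine (congrArg (· ≫ _) (forgetT0_graph _)).trans ((T0.graph_comp _ _).trans ?_)
    exact congrArg T0.graph (prodOverUnit_left_fst x₀ X.obj)
  right_triangle_components X := by
    refine (congrArg (_ ≫ ·) (PreservesRelations.mapT0_graph _ _)).trans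
      ((T0.graph_comp _ _).trans ?_)
    exact congrArg T0.graph (prodOverUnit_map_fst x₀ X.obj)

end T0Adjunction

/-! ### Adjunctions and additive Karoubi completions -/

section Completion

variable {C D : Type*} [Category* C] [Category* D]

/-- The bijection of an adjunction preserves compatibility with idempotents. -/
theorem homEquiv_idem {F : C ⥤ D} {G : D ⥤ C} (adj : F ⊣ G) {X : C} {Y : D} {p : X ⟶ X}
    {q : Y ⟶ Y} {f : F.obj X ⟶ Y} (h : F.map p ≫ f ≫ q = f) :
    p ≫ adj.homEquiv X Y f ≫ G.map q = adj.homEquiv X Y f := by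
  rw [← adj.homEquiv_naturality_right, ← adj.homEquiv_naturality_left, h]

theorem homEquiv_symm_idem {F : C ⥤ D} {G : D ⥤ C} (adj : F ⊣ G) {X : C} {Y : D} {p : X ⟶ X}
    {q : Y ⟶ Y} {f : X ⟶ G.obj Y} (h : p ≫ f ≫ G.map q = f) :
    F.map p ≫ (adj.homEquiv X Y).symm f ≫ q = (adj.homEquiv X Y).symm f := by
  rw [← adj.homEquiv_naturality_right_symm, ← adj.homEquiv_naturality_left_symm, h]

/-- An adjunction extends to the Karoubi completions. -/
def karoubiAdjunction {F : C ⥤ D} {G : D ⥤ C} (adj : F ⊣ G) :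
    (Idempotents.functorExtension₂ C D).obj F ⊣ (Idempotents.functorExtension₂ D C).obj G :=
  Adjunction.mkOfHomEquiv
    { homEquiv := fun P Q =>
        { toFun := fun f => ⟨adj.homEquiv P.X Q.X f.f, homEquiv_idem adj f.comm⟩
          invFun := fun f => ⟨(adj.homEquiv P.X Q.X).symm f.f, homEquiv_symm_idem adj f.comm⟩
          left_inv := fun f => Idempotents.Karoubi.hom_ext_iff.2
            ((adj.homEquiv P.X Q.X).symm_apply_apply f.f)
          right_inv := fun f => Idempotents.Karoubi.hom_ext_iff.2
            ((adj.homEquiv P.X Q.X).apply_symm_apply f.f) }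
      homEquiv_naturality_left_symm := fun f g => Idempotents.Karoubi.hom_ext_iff.2
        (adj.homEquiv_naturality_left_symm f.f g.f)
      homEquiv_naturality_right := fun f g => Idempotents.Karoubi.hom_ext_iff.2
        (adj.homEquiv_naturality_right f.f g.f) }

end Completion

section Completion

variable {C : Type u} [Category.{v} C] [Preadditive C] {D : Type u'} [Category.{v} D]
  [Preadditive D]

/-- An adjunction between additive functors extends to the additive completions. -/
noncomputable def matAdjunction {F : C ⥤ D} {G : D ⥤ C} [F.Additive] [G.Additive] (adj : F ⊣ G) :
    F.mapMat_ ⊣ G.mapMat_ :=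
  Adjunction.mkOfHomEquiv
    { homEquiv := fun X Y =>
        { toFun := fun f i j => adj.homEquiv _ _ (f i j)
          invFun := fun f i j => (adj.homEquiv _ _).symm (f i j)
          left_inv := fun f => by ext i j; exact (adj.homEquiv _ _).symm_apply_apply _
          right_inv := fun f => by ext i j; exact (adj.homEquiv _ _).apply_symm_apply _ }
      homEquiv_naturality_left_symm := fun {X' X Y} f g => by
        ext i j
        change (adj.homEquiv (X'.X i) (Y.X j)).symm (∑ k : X.ι, f i k ≫ g k j) =
          ∑ k : X.ι, F.map (f i k) ≫ (adj.homEquiv (X.X k) (Y.X j)).symm (g k j)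
        rw [Adjunction.homEquiv_counit, F.map_sum, Preadditive.sum_comp]
        refine Finset.sum_congr rfl fun k _ => ?_
        rw [← Adjunction.homEquiv_counit]
        exact adj.homEquiv_naturality_left_symm (f i k) (g k j)
      homEquiv_naturality_right := fun {X Y Y'} f g => by
        ext i j
        change adj.homEquiv (X.X i) (Y'.X j) (∑ k : Y.ι, f i k ≫ g k j) =
          ∑ k : Y.ι, adj.homEquiv (X.X i) (Y.X k) (f i k) ≫ G.map (g k j)
        rw [Adjunction.homEquiv_unit, G.map_sum, Preadditive.comp_sum]
        refine Finset.sum_congr rfl fun k _ => ?_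
        rw [← Adjunction.homEquiv_unit]
        exact adj.homEquiv_naturality_right (f i k) (g k j) }

end Completion

namespace PreservesRelations

variable {A : Type u} [Category.{v} A] {B : Type (max u v)} [Category.{v} B] [KnopRegular A]
  [KnopRegular B] {K : Type w} [CommRing K] {F : A ⥤ B} {δ : DegreeFunction A K}
  {δ' : DegreeFunction B K} (hF : PreservesRelations F δ δ')

theorem mapT_additive : hF.mapT.Additive where
  map_add {X Y f g} := by
    refine Idempotents.Karoubi.hom_ext_iff.2 ?_
    funext i j
    exact hF.mapT0.map_add (f := f.f i j) (g := g.f i j)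

theorem mapT_linear : hF.mapT.Linear K where
  map_smul {X Y} f r := by
    refine Idempotents.Karoubi.hom_ext_iff.2 ?_
    funext i j
    exact hF.mapT0.map_smul r (f.f i j)

end PreservesRelations

theorem preservesFiniteLimits_prodOverBar {A : Type u} [Category.{v} A] [KnopRegular A]
    {K : Type w} [CommRing K] (δ : DegreeFunction A K) (x₀ : A) [∀ x : A, HasBinaryProduct x x₀] :
    PreservesFiniteLimits (prodOverBar x₀ δ) := by
  have : PreservesLimits (prodOverBar x₀ δ) :=
    (karoubiAdjunction (matAdjunction (forgetT0Adj δ x₀))).rightAdjoint_preservesLimits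
  exact PreservesLimits.preservesFiniteLimits _

/-! ### Comparison maps for products -/

section ProdComparison

variable {A : Type u} [Category.{v} A] {B : Type u'} [Category.{v'} B] (F : A ⥤ B)

theorem prodComparison_assoc (x y z : A) [HasBinaryProduct x y] [HasBinaryProduct (x ⨯ y) z]
    [HasBinaryProduct y z] [HasBinaryProduct x (y ⨯ z)]
    [HasBinaryProduct (F.obj x) (F.obj y)] [HasBinaryProduct (F.obj x ⨯ F.obj y) (F.obj z)]
    [HasBinaryProduct (F.obj y) (F.obj z)] [HasBinaryProduct (F.obj x) (F.obj y ⨯ F.obj z)]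
    [HasBinaryProduct (F.obj (x ⨯ y)) (F.obj z)] [HasBinaryProduct (F.obj x) (F.obj (y ⨯ z))] :
    prodComparison F (x ⨯ y) z ≫ prod.map (prodComparison F x y) (𝟙 (F.obj z)) ≫
        assocHom (F.obj x) (F.obj y) (F.obj z) =
      F.map (assocHom x y z) ≫ prodComparison F x (y ⨯ z) ≫
        prod.map (𝟙 (F.obj x)) (prodComparison F y z) := by
  unfold assocHom prodComparison
  ext <;> simp [prod.lift_fst, prod.lift_snd, prod.lift_fst_assoc] <;>
    simp only [← F.map_comp, prod.lift_fst, prod.lift_snd, prod.lift_snd_assoc]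

theorem prodComparison_swap (x y : A) [HasBinaryProduct x y] [HasBinaryProduct y x]
    [HasBinaryProduct (F.obj x) (F.obj y)] [HasBinaryProduct (F.obj y) (F.obj x)] :
    F.map (prod.lift prod.snd prod.fst : x ⨯ y ⟶ y ⨯ x) ≫ prodComparison F y x =
      prodComparison F x y ≫ prod.lift prod.snd prod.fst := by
  unfold prodComparison
  ext <;> simp [prod.lift_fst, prod.lift_snd, ← F.map_comp]

theorem prodComparison_left_unit [HasTerminal A] [HasTerminal B] (x : A)
    [HasBinaryProduct (⊤_ A) x] [HasBinaryProduct (F.obj (⊤_ A)) (F.obj x)]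
    [HasBinaryProduct (⊤_ B) (F.obj x)] :
    prod.lift (terminal.from (F.obj x)) (𝟙 (F.obj x)) =
      F.map (prod.lift (terminal.from x) (𝟙 x)) ≫ prodComparison F (⊤_ A) x ≫
        prod.map (terminal.from (F.obj (⊤_ A))) (𝟙 (F.obj x)) := by
  unfold prodComparison
  apply prod.hom_ext
  · exact terminal.hom_ext _ _
  · simp [prod.lift_snd, ← F.map_comp]

theorem prodComparison_right_unit [HasTerminal A] [HasTerminal B] (x : A)
    [HasBinaryProduct x (⊤_ A)] [HasBinaryProduct (F.obj x) (F.obj (⊤_ A))]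
    [HasBinaryProduct (F.obj x) (⊤_ B)] :
    prod.lift (𝟙 (F.obj x)) (terminal.from (F.obj x)) =
      F.map (prod.lift (𝟙 x) (terminal.from x)) ≫ prodComparison F x (⊤_ A) ≫
        prod.map (𝟙 (F.obj x)) (terminal.from (F.obj (⊤_ A))) := by
  unfold prodComparison
  apply prod.hom_ext
  · simp [prod.lift_fst, ← F.map_comp]
  · exact terminal.hom_ext _ _

theorem hasBinaryProduct_map {x y : A} [PreservesFiniteLimits F] (h : HasBinaryProduct x y) :
    HasBinaryProduct (F.obj x) (F.obj y) :=
  ⟨⟨_, isLimitOfHasBinaryProductOfPreservesLimit F x y⟩⟩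

end ProdComparison

/-! ### The monoidal structure on the additive completion -/

namespace PreservesRelations

open T0Mat

variable {A : Type u} [Category.{v} A] {B : Type (max u v)} [Category.{v} B] [KnopRegular A]
  [KnopRegular B] {K : Type w} [CommRing K] {F : A ⥤ B} {δ : DegreeFunction A K}
  {δ' : DegreeFunction B K} (hF : PreservesRelations F δ δ')

/-- The image of a family of objects. -/
abbrev mapObj (_hF : PreservesRelations F δ δ') (X : Mat_ (T0 δ)) : Mat_ (T0 δ') where
  ι := X.ι
  X i := T0.of (F.obj (X.X i).obj)

/-- The image of a matrix. -/
noncomputable abbrev mapMat {X Y : Mat_ (T0 δ)} (f : X ⟶ Y) : hF.mapObj X ⟶ hF.mapObj Y :=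
  hF.mapT0.mapMat_.map f

theorem mapMat_gmat {X Y : Mat_ (T0 δ)} (φ : X.ι → Y.ι)
    (f : ∀ i, (X.X i).obj ⟶ (Y.X (φ i)).obj) :
    hF.mapMat (gmat φ f) =
      gmat (X := hF.mapObj X) (Y := hF.mapObj Y) φ (fun i => F.map (f i)) := by
  funext i j
  change hF.mapT0.map (gmat φ f i j) = _
  by_cases h : φ i = j
  · subst h
    rw [gmat_apply_self, mapT0_graph]
    exact (gmat_apply_self (X := hF.mapObj X) (Y := hF.mapObj Y) φ (fun i => F.map (f i)) i).symm
  · rw [gmat_apply_ne φ f h, Functor.map_zero]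
    exact (gmat_apply_ne (X := hF.mapObj X) (Y := hF.mapObj Y) φ (fun i => F.map (f i)) h).symm

variable [PreservesFiniteLimits F]

/-- A functor that preserves terminal objects and reflects the existence of pullbacks reflects the
existence of products. -/
theorem hasBinaryProduct_of_map_maps (hF : PreservesRelations F δ δ') {x y : A} {w : B}
    (f : w ⟶ F.obj x) (g : w ⟶ F.obj y) : HasBinaryProduct x y := by
  have : HasPullback (F.map (terminal.from x)) (F.map (terminal.from y)) :=
    KnopRegular.hasPullback_of_commSq f g _ _
      ((terminalIsTerminal.isTerminalObj F _).hom_ext _ _)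
  have := hF.hasPullback (terminal.from x) (terminal.from y) this
  exact hasBinaryProduct_of_maps (pullback.fst (terminal.from x) (terminal.from y))
    (pullback.snd _ _)

theorem hasBinaryProduct_of_map (hF : PreservesRelations F δ δ') {x y : A}
    (_ : HasBinaryProduct (F.obj x) (F.obj y)) : HasBinaryProduct x y :=
  hF.hasBinaryProduct_of_map_maps (prod.fst : F.obj x ⨯ F.obj y ⟶ F.obj x) prod.snd

theorem mapLin_tensLin {x y x' y' : A} [HasBinaryProduct x x'] [HasBinaryProduct y y']
    [HasBinaryProduct (F.obj x) (F.obj x')] [HasBinaryProduct (F.obj y) (F.obj y')]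
    (f : Relation x y →₀ K) (f' : Relation x' y' →₀ K) :
    compLin δ' _ _ _ (hF.mapLin _ _ (tensLin δ x y x' y' f f'))
        (spanClass δ' (𝟙 _) (prodComparison F y y')) =
      compLin δ' _ _ _ (spanClass δ' (𝟙 _) (prodComparison F x x'))
        (tensLin δ' _ _ _ _ (hF.mapLin x y f) (hF.mapLin x' y' f')) := by
  induction f using hom_induction δ with
  | zero => simp
  | add f g hf hg => simp only [map_add, LinearMap.add_apply, hf, hg]
  | span k a b =>
    induction f' using hom_induction δ with
    | zero => simp
    | add f g hf hg => simp only [map_add, LinearMap.add_apply, hf, hg]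
    | span k' a' b' =>
      rename_i P P'
      simp only [map_smul, LinearMap.smul_apply, mapLin_span]
      congr 2
      by_cases h : HasBinaryProduct P P'
      · have := hasBinaryProduct_map F h
        -- Both vertical sides are isomorphisms, so the naturality square of the comparison is
        -- Cartesian.
        have hp : IsPullback (F.map (prod.map a a')) (prodComparison F P P')
            (prodComparison F x x') (prod.map (F.map a) (F.map a')) :=
          IsPullback.of_vert_isIso ⟨prodComparison_natural F a a'⟩
        rw [tensLin_span, tensLin_span, mapLin_span, compLin_span_graph,
          compLin_graph_span_of_isPullback _ hp, prodComparison_natural]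
      · rw [tensLin_span_of_forall, tensLin_span_of_forall, map_zero, map_zero, map_zero,
          LinearMap.zero_apply]
        · exact fun w f g => h (hF.hasBinaryProduct_of_map_maps f g)
        · exact fun w f g => h (hasBinaryProduct_of_maps f g)

/-- The reindexing underlying the comparison `F (X ⊗ Y) ⟶ F X ⊗ F Y`. -/
def compIdx {X Y : Mat_ (T0 δ)} (p : (tensorObj X Y).ι) :
    (tensorObj (hF.mapObj X) (hF.mapObj Y)).ι :=
  ⟨p.1, hasBinaryProduct_map F p.2⟩

/-- The inverse of the reindexing underlying the comparison: `x ⨯ y` exists as soon as `F x ⨯ F y`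
does. -/
def compIdxInv {X Y : Mat_ (T0 δ)} (p : (tensorObj (hF.mapObj X) (hF.mapObj Y)).ι) :
    (tensorObj X Y).ι :=
  ⟨p.1, hF.hasBinaryProduct_of_map p.2⟩

/-- The components of the comparison: the maps `F (x ⨯ y) ⟶ F x ⨯ F y`. -/
noncomputable def compComp {X Y : Mat_ (T0 δ)} (p : (tensorObj X Y).ι) :
    ((hF.mapObj (tensorObj X Y)).X p).obj ⟶
      ((tensorObj (hF.mapObj X) (hF.mapObj Y)).X (hF.compIdx p)).obj :=
  haveI := p.2
  haveI := hasBinaryProduct_map F p.2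
  prodComparison F (X.X p.1.1).obj (Y.X p.1.2).obj

/-- The components of the inverse of the comparison. -/
noncomputable def compCompInv {X Y : Mat_ (T0 δ)}
    (p : (tensorObj (hF.mapObj X) (hF.mapObj Y)).ι) :
    ((tensorObj (hF.mapObj X) (hF.mapObj Y)).X p).obj ⟶
      ((hF.mapObj (tensorObj X Y)).X (hF.compIdxInv p)).obj :=
  haveI : HasBinaryProduct (X.X p.1.1).obj (Y.X p.1.2).obj := hF.hasBinaryProduct_of_map p.2
  haveI : HasBinaryProduct (F.obj (X.X p.1.1).obj) (F.obj (Y.X p.1.2).obj) := p.2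
  (PreservesLimitPair.iso F (X.X p.1.1).obj (Y.X p.1.2).obj).inv

/-- The comparison `F (X ⊗ Y) ⟶ F X ⊗ F Y`. -/
noncomputable def comparison (X Y : Mat_ (T0 δ)) :
    hF.mapObj (tensorObj X Y) ⟶ tensorObj (hF.mapObj X) (hF.mapObj Y) :=
  gmat hF.compIdx hF.compComp

/-- The comparison `F (X ⊗ Y) ⟶ F X ⊗ F Y` is an isomorphism. -/
noncomputable def comparisonIso (X Y : Mat_ (T0 δ)) :
    hF.mapObj (tensorObj X Y) ≅ tensorObj (hF.mapObj X) (hF.mapObj Y) :=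
  gmatIso hF.compIdx hF.compIdxInv hF.compComp hF.compCompInv
    (gmat_eq_id (fun _ => rfl) fun p =>
      haveI := p.2
      haveI := hasBinaryProduct_map F p.2
      heq_of_eq (PreservesLimitPair.iso F (X.X p.1.1).obj (Y.X p.1.2).obj).hom_inv_id)
    (gmat_eq_id (fun _ => rfl) fun p =>
      haveI : HasBinaryProduct (X.X p.1.1).obj (Y.X p.1.2).obj := hF.hasBinaryProduct_of_map p.2
      haveI : HasBinaryProduct (F.obj (X.X p.1.1).obj) (F.obj (Y.X p.1.2).obj) := p.2
      heq_of_eq (PreservesLimitPair.iso F (X.X p.1.1).obj (Y.X p.1.2).obj).inv_hom_id)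

/-- The isomorphism between the image of the unit object and the unit object. -/
noncomputable def unitIso : hF.mapObj (unit δ) ≅ unit δ' :=
  gmatIso (X := hF.mapObj (unit δ)) (Y := unit δ') id id
    (fun _ => terminal.from (F.obj (⊤_ A)))
    (fun _ => (terminalIsTerminal.isTerminalObj F _).from (⊤_ B))
    (gmat_eq_id (fun _ => rfl) fun _ =>
      heq_of_eq ((terminalIsTerminal.isTerminalObj F _).hom_ext _ _))
    (gmat_eq_id (fun _ => rfl) fun _ => heq_of_eq (terminal.hom_ext _ _))

theorem comparison_naturality {X Y X' Y' : Mat_ (T0 δ)} (f : X ⟶ Y) (g : X' ⟶ Y') :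
    hF.comparison X X' ≫ tensorHom (hF.mapMat f) (hF.mapMat g) =
      hF.mapMat (tensorHom f g) ≫ hF.comparison Y Y' := by
  funext p q
  obtain ⟨q, rfl⟩ : ∃ q' : (tensorObj Y Y').ι, hF.compIdx q' = q := ⟨hF.compIdxInv q, rfl⟩
  have hinj : Function.Injective (hF.compIdx (X := Y) (Y := Y')) :=
    Function.LeftInverse.injective (g := hF.compIdxInv) fun _ => rfl
  refine (gmat_comp_apply _ _ _ p _).trans (Eq.trans ?_
    (comp_gmat_apply (Y := hF.mapObj (tensorObj Y Y')) _ hinj hF.compComp _ p q).symm)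
  have := p.2
  have := hasBinaryProduct_map F p.2
  have := q.2
  have := hasBinaryProduct_map F q.2
  exact (hF.mapLin_tensLin (f p.1.1 q.1.1) (g p.1.2 q.1.2)).symm

theorem comparison_assoc (X Y Z : Mat_ (T0 δ)) :
    hF.comparison (tensorObj X Y) Z ≫ tensorHom (hF.comparison X Y) (𝟙 (hF.mapObj Z)) ≫
        gmat assocIdx assocComp =
      hF.mapMat (gmat assocIdx assocComp) ≫ hF.comparison X (tensorObj Y Z) ≫
        tensorHom (𝟙 (hF.mapObj X)) (hF.comparison Y Z) := by
  rw [mapMat_gmat, ← gmat_id, ← gmat_id]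
  unfold comparison
  rw [tensorHom_gmat, tensorHom_gmat, gmat_comp, gmat_comp, gmat_comp, gmat_comp]
  refine gmat_congr (fun _ => rfl) fun (p : (tensorObj (tensorObj X Y) Z).ι) => heq_of_eq ?_
  have h1 := p.1.1.2
  have h2 := p.2
  have h3 := hasProd_right h1 h2
  have h4 := hasProd_assoc h1 h2 h3
  have h1' := hasBinaryProduct_map F h1
  have h2' := hasBinaryProduct_map F h2
  have h3' := hasBinaryProduct_map F h3
  have h4' := hasBinaryProduct_map F h4
  have h5 := hasProd_of_maps h2' (prodComparison F (X.X p.1.1.1.1).obj (Y.X p.1.1.1.2).obj) (𝟙 _)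
  have h6 := hasProd_of_maps h4' (𝟙 _) (prodComparison F (Y.X p.1.1.1.2).obj (Z.X p.1.2).obj)
  exact prodComparison_assoc F (X.X p.1.1.1.1).obj (Y.X p.1.1.1.2).obj (Z.X p.1.2).obj

theorem comparison_swap (X Y : Mat_ (T0 δ)) :
    hF.mapMat (swap X Y) ≫ hF.comparison Y X =
      hF.comparison X Y ≫ swap (hF.mapObj X) (hF.mapObj Y) := by
  unfold swap comparison
  rw [mapMat_gmat, gmat_comp, gmat_comp]
  refine gmat_congr (fun _ => rfl) fun (p : (tensorObj X Y).ι) => heq_of_eq ?_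
  have := p.2
  have := hasProd_symm p.2
  have := hasBinaryProduct_map F p.2
  have := hasProd_symm (hasBinaryProduct_map F p.2)
  exact prodComparison_swap F (X.X p.1.1).obj (Y.X p.1.2).obj

theorem comparison_left_unit (X : Mat_ (T0 δ)) :
    (MonoidalCategory.leftUnitor (hF.mapObj X)).inv =
      hF.mapMat (MonoidalCategory.leftUnitor X).inv ≫
        hF.comparison (unit δ) X ≫ tensorHom hF.unitIso.hom (𝟙 (hF.mapObj X)) := by
  have hX : (MonoidalCategory.leftUnitor X).inv =
      gmat (Y := tensorObj (unit δ) X) (fun i => ⟨((), i), hasProd_terminal_left _⟩)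
        (fun i => haveI := hasProd_terminal_left (X.X i).obj;
          prod.lift (terminal.from (X.X i).obj) (𝟙 (X.X i).obj)) := rfl
  have hu : hF.unitIso.hom = gmat (X := hF.mapObj (unit δ)) (Y := unit δ') id
      (fun _ => terminal.from (F.obj (⊤_ A))) := rfl
  rw [hX, hu, ← gmat_id]
  refine Eq.trans ?_ (congrArg (· ≫ _) (hF.mapMat_gmat _ _)).symm
  unfold comparison
  rw [tensorHom_gmat, gmat_comp]
  refine Eq.trans ?_
    (gmat_comp (X := hF.mapObj X) (Y := hF.mapObj (tensorObj (unit δ) X)) _ _ _ _).symm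
  refine gmat_congr (Y := tensorObj (unit δ') (hF.mapObj X)) (fun _ => rfl) fun i => heq_of_eq ?_
  have := hasProd_terminal_left (X.X i).obj
  have := hasBinaryProduct_map F this
  have := hasProd_terminal_left (F.obj (X.X i).obj)
  exact prodComparison_left_unit F (X.X i).obj

theorem comparison_right_unit (X : Mat_ (T0 δ)) :
    (MonoidalCategory.rightUnitor (hF.mapObj X)).inv =
      hF.mapMat (MonoidalCategory.rightUnitor X).inv ≫
        hF.comparison X (unit δ) ≫ tensorHom (𝟙 (hF.mapObj X)) hF.unitIso.hom := by
  have hX : (MonoidalCategory.rightUnitor X).inv =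
      gmat (Y := tensorObj X (unit δ)) (fun i => ⟨(i, ()), hasProd_terminal_right _⟩)
        (fun i => haveI := hasProd_terminal_right (X.X i).obj;
          prod.lift (𝟙 (X.X i).obj) (terminal.from (X.X i).obj)) := rfl
  have hu : hF.unitIso.hom = gmat (X := hF.mapObj (unit δ)) (Y := unit δ') id
      (fun _ => terminal.from (F.obj (⊤_ A))) := rfl
  rw [hX, hu, ← gmat_id]
  refine Eq.trans ?_ (congrArg (· ≫ _) (hF.mapMat_gmat _ _)).symm
  unfold comparison
  rw [tensorHom_gmat, gmat_comp]
  refine Eq.trans ?_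
    (gmat_comp (X := hF.mapObj X) (Y := hF.mapObj (tensorObj X (unit δ))) _ _ _ _).symm
  refine gmat_congr (Y := tensorObj (hF.mapObj X) (unit δ')) (fun _ => rfl) fun i => heq_of_eq ?_
  have := hasProd_terminal_right (X.X i).obj
  have := hasBinaryProduct_map F this
  have := hasProd_terminal_right (F.obj (X.X i).obj)
  exact prodComparison_right_unit F (X.X i).obj

/-- The monoidal structure on the functor induced on additive completions. -/
@[reducible]
noncomputable def mapMatMonoidal : hF.mapT0.mapMat_.Monoidal :=
  (Functor.CoreMonoidal.mk' hF.unitIso.symm (fun X Y => (hF.comparisonIso X Y).symm)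
    (fun f X' => (congrArg (fun g => hF.comparison _ X' ≫ tensorHom (hF.mapMat f) g)
      (hF.mapT0.mapMat_.map_id X')).symm.trans (hF.comparison_naturality f (𝟙 X')))
    (fun X' f => (congrArg (fun g => hF.comparison X' _ ≫ tensorHom g (hF.mapMat f))
      (hF.mapT0.mapMat_.map_id X')).symm.trans (hF.comparison_naturality (𝟙 X') f))
    hF.comparison_assoc hF.comparison_left_unit hF.comparison_right_unit).toMonoidal

/-- The monoidal structure on the functor induced on additive completions is compatible with the
symmetries. -/
@[reducible]
noncomputable def mapMatBraided : hF.mapT0.mapMat_.Braided where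
  __ := hF.mapMatMonoidal
  braided X Y := by
    change (hF.comparisonIso X Y).inv ≫ hF.mapMat (swap X Y) =
      swap (hF.mapObj X) (hF.mapObj Y) ≫ (hF.comparisonIso Y X).inv
    rw [Iso.inv_comp_eq, ← Category.assoc, Iso.eq_comp_inv]
    exact hF.comparison_swap X Y

end PreservesRelations

/-! ### The monoidal structure on the Karoubi completion -/

section KaroubiFunctor

open MonoidalCategory Idempotents

variable {C : Type u} [Category.{v} C] {D : Type u'} [Category.{v'} D] (F : C ⥤ D)

theorem InducedBy.map {P Q : Karoubi C} {f : P ⟶ Q} {i : P.X ⟶ Q.X} (h : InducedBy f i) :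
    InducedBy (((functorExtension₂ C D).obj F).map f) (F.map i) :=
  ⟨(congrArg F.map h.1).trans (F.map_comp _ _),
    (F.map_comp _ _).symm.trans ((congrArg F.map h.2).trans (F.map_comp _ _))⟩

variable [MonoidalCategory C] [MonoidalCategory D] [F.Monoidal]

/-- The tensorator of the extension of a monoidal functor to the Karoubi completions. -/
def karoubiμIso (P Q : Karoubi C) :
    karoubiTensorObj (((functorExtension₂ C D).obj F).obj P)
      (((functorExtension₂ C D).obj F).obj Q) ≅
      ((functorExtension₂ C D).obj F).obj (karoubiTensorObj P Q) :=
  karoubiIso (Functor.Monoidal.μIso F P.X Q.X) (Functor.LaxMonoidal.μ_natural F P.p Q.p)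

theorem karoubiμIso_hom (P Q : Karoubi C) :
    InducedBy (karoubiμIso F P Q).hom (Functor.LaxMonoidal.μ F P.X Q.X) := .iso_hom _ _

/-- The unit isomorphism of the extension of a monoidal functor to the Karoubi completions. -/
def karoubiεIso :
    karoubiUnit D ≅ ((functorExtension₂ C D).obj F).obj (karoubiUnit C) :=
  karoubiIso (Functor.Monoidal.εIso F)
    ((Category.id_comp _).trans ((congrArg (_ ≫ ·) (F.map_id _)).trans (Category.comp_id _)).symm)

theorem karoubiεIso_hom : InducedBy (karoubiεIso F).hom (Functor.LaxMonoidal.ε F) := .iso_hom _ _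

/-- The extension of a monoidal functor to the Karoubi completions is monoidal. -/
@[reducible]
def karoubiMonoidal : ((functorExtension₂ C D).obj F).Monoidal :=
  Functor.CoreMonoidal.toMonoidal
    { εIso := karoubiεIso F
      μIso := karoubiμIso F
      μIso_hom_natural_left := fun f X' =>
        (karoubiμIso_hom F _ _).naturality (karoubiμIso_hom F _ _) _ _
          (Functor.LaxMonoidal.μ_natural F f.f X'.p)
      μIso_hom_natural_right := fun X' f =>
        (karoubiμIso_hom F _ _).naturality (karoubiμIso_hom F _ _) _ _
          (Functor.LaxMonoidal.μ_natural F X'.p f.f)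
      associativity := fun X Y Z =>
        (((karoubiμIso_hom F X Y).tensor (.id _)).comp
          ((karoubiμIso_hom F (karoubiTensorObj X Y) Z).comp
            ((karoubiAssoc_hom X Y Z).map F))).eq
          ((karoubiAssoc_hom _ _ _).comp (((InducedBy.id _).tensor (karoubiμIso_hom F Y Z)).comp
            (karoubiμIso_hom F X (karoubiTensorObj Y Z))))
          ((congrArg (· ≫ _) (tensorHom_id _ _)).trans
            ((Functor.LaxMonoidal.associativity F X.X Y.X Z.X).trans
              (congrArg (fun f => _ ≫ f ≫ _) (id_tensorHom _ _).symm)))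
      left_unitality := fun X =>
        (karoubiLeftUnitor_hom _).eq
          (((karoubiεIso_hom F).tensor (.id _)).comp ((karoubiμIso_hom F (karoubiUnit C) X).comp
            ((karoubiLeftUnitor_hom X).map F)))
          ((Functor.LaxMonoidal.left_unitality F X.X).trans
            (congrArg (· ≫ _) (tensorHom_id _ _).symm))
      right_unitality := fun X =>
        (karoubiRightUnitor_hom _).eq
          (((InducedBy.id _).tensor (karoubiεIso_hom F)).comp
            ((karoubiμIso_hom F X (karoubiUnit C)).comp ((karoubiRightUnitor_hom X).map F)))
          ((Functor.LaxMonoidal.right_unitality F X.X).trans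
            (congrArg (· ≫ _) (id_tensorHom _ _).symm)) }

/-- The extension of a braided functor to the Karoubi completions is braided. -/
@[reducible]
def karoubiBraided {C : Type u} [Category.{v} C] {D : Type u'} [Category.{v'} D] (F : C ⥤ D)
    [MonoidalCategory C] [MonoidalCategory D] [BraidedCategory C] [BraidedCategory D]
    [F.Braided] : ((functorExtension₂ C D).obj F).Braided where
  __ := karoubiMonoidal F
  braided X Y :=
    ((karoubiμIso_hom F X Y).comp ((karoubiBraiding_hom X Y).map F)).eq
      ((karoubiBraiding_hom _ _).comp (karoubiμIso_hom F Y X))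
      (Functor.LaxBraided.braided X.X Y.X)

end KaroubiFunctor

/-- A functor that transports relations and preserves finite limits induces a symmetric monoidal
functor between Knop's tensor categories. -/
@[reducible]
noncomputable def PreservesRelations.mapTBraided {A : Type u} [Category.{v} A] {B : Type (max u v)}
    [Category.{v} B] [KnopRegular A] [KnopRegular B] {K : Type w} [CommRing K] {F : A ⥤ B}
    {δ : DegreeFunction A K} {δ' : DegreeFunction B K} (hF : PreservesRelations F δ δ')
    [PreservesFiniteLimits F] : hF.mapT.Braided :=
  haveI := hF.mapMatBraided
  karoubiBraided hF.mapT0.mapMat_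

theorem preservesFiniteLimits_prodOver {A : Type u} [Category.{v} A] (x₀ : A)
    [∀ x : A, HasBinaryProduct x x₀] : PreservesFiniteLimits (prodOver x₀) := by
  have : PreservesLimits (prodOver x₀) := (forgetAdjProdOver x₀).rightAdjoint_preservesLimits
  exact PreservesLimits.preservesFiniteLimits _

end DeligneKnop

theorem mainTheorem4 {K : Type w} [Field K] :
    (∀ {A : Type u} [Category.{v} A] [DeligneKnop.KnopRegular A]
        (δ : DeligneKnop.DegreeFunction A K) (x₀ : A) [∀ x : A, HasBinaryProduct x x₀],
      (∃ adj : Over.forget x₀ ⊣ DeligneKnop.prodOver x₀,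
        NatTrans.Equifibered adj.unit ∧ NatTrans.Equifibered adj.counit) ∧
      PreservesFiniteLimits (DeligneKnop.prodOver x₀) ∧
      (DeligneKnop.prodOverBar x₀ δ).Additive ∧
      (DeligneKnop.prodOverBar x₀ δ).Linear K ∧
      Nonempty (DeligneKnop.prodOverBar x₀ δ).Braided ∧
      PreservesFiniteLimits (DeligneKnop.prodOverBar x₀ δ)) ∧
    (∀ (k : Type u') [Field k] [Finite k] (t : K) (V₀ : FGModuleCat.{u'} k),
      (DeligneKnop.prodOverBar V₀ (DeligneKnop.vectDegree k t) :
        DeligneKnop.RepGL k t ⥤ DeligneKnop.T ((DeligneKnop.vectDegree k t).over V₀)).Linear K ∧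
      Nonempty (DeligneKnop.prodOverBar V₀ (DeligneKnop.vectDegree k t)).Braided ∧
      PreservesFiniteLimits (DeligneKnop.prodOverBar V₀ (DeligneKnop.vectDegree k t))) := by
  refine ⟨fun δ x₀ _ => ?_, fun k _ _ t V₀ => ?_⟩
  · have := DeligneKnop.preservesFiniteLimits_prodOver x₀
    have hF := DeligneKnop.prodOver_preservesRelations x₀ δ
    exact ⟨⟨DeligneKnop.forgetAdjProdOver x₀,
      DeligneKnop.forgetAdjProdOver_unit_equifibered x₀,
      DeligneKnop.forgetAdjProdOver_counit_equifibered x₀⟩, this, hF.mapT_additive,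
      hF.mapT_linear, ⟨hF.mapTBraided⟩, DeligneKnop.preservesFiniteLimits_prodOverBar δ x₀⟩
  · have := DeligneKnop.preservesFiniteLimits_prodOver V₀
    have hF := DeligneKnop.prodOver_preservesRelations V₀ (DeligneKnop.vectDegree k t)
    exact ⟨hF.mapT_linear, ⟨hF.mapTBraided⟩, DeligneKnop.preservesFiniteLimits_prodOverBar _ V₀⟩
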